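/- Let $m\ge 1$ be an integer and $\mathbb N=\{0,1,2,\dots\}$. For $n\in\mathbb N^m$ write $|n|=n_1+\dots+n_m$ and $n!=n_1!\cdots n_m!$, and let $\varepsilon_j\in\mathbb N^m$ have $1$ in the $j$-th place and zeros elsewhere. Let $\beta=(\beta_n)_{n\in\mathbb N^m}$ be a family of positive numbers, and let $H^2(\beta)$ be the Hilbert space of formal power series $f(z)=\sum_{n\in\mathbb N^m}a_nz^n$ with complex coefficients such that $\|f\|_\beta^2=\sum_{n}|a_n|^2\beta_n^2<\infty$. For such $f$ let $f_{[k]}=\sum_{|n|=k}a_nz^n$ be its homogeneous part of degree $k$. Let $\sigma$ be the normalized surface area measure on the unit sphere $\partial\mathbb B$ of $\mathbb C^m$, and $\|p\|^2_{L^2(\partial\mathbb B)}=\int_{\partial\mathbb B}|p|^2\,d\sigma$ for polynomials $p$. An $m$-tuple $T=(T_1,\dots,T_m)$ of commuting bounded linear operators on an infinite-dimensional complex Hilbert space $\mathcal H$ is called spherical if for every unitary $m\times m$ matrix $U=(u_{jk})$ there is a unitary operator $\Gamma(U)$ on $\mathcal H$ such that $\Gamma(U)T_j=\big(\sum_{k=1}^m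 u_{jk}T_k\big)\Gamma(U)$ for all $j=1,\dots,m$. **Theorem.** Suppose that the multiplication $m$-tuple $M_z=(M_{z_1},\dots,M_{z_m})$, $M_{z_j}f=z_jf$, consists of bounded operators on $H^2(\beta)$. Then $M_z$ is spherical if and only if there is a sequence $\mathfrak b_0,\mathfrak b_1,\mathfrak b_2,\dots$ of positive numbers such that $$\|f\|_\beta^2=\sum_{k=0}^\infty \mathfrak b_k^2\,\|f_{[k]}\|^2_{L^2(\partial\mathbb B)}\qquad\text{for all } f\in H^2(\beta).\tag{1}$$ Moreover, for every sequence $(\mathfrak b_k)$ of positive numbers satisfying (1), the tuple $M_z$ is unitarily equivalent to the (bounded, commuting) $m$-variable weighted shift $T=(T_1,\dots,T_m)$, $T_ie_n=w^{(i)}_ne_{n+\varepsilon_i}$, with respect to an orthonormal basis $(e_n)_{n\in\mathbb N^m}$ of a Hilbert space, with the weights $$w^{(i)}_n=\frac{\mathfrak b_{|n|+1}}{\mathfrak b_{|n|}}\sqrt{\frac{n_i+1}{|n|+m}}\qquad(n\in\mathbb N^m,\ 1\le i\le m),$$ and $$\beta_n=\mathfrak b_{|n|}\sqrt{\frac{(m-1)!\,n!}{(m-1+|n|)!}}\qquad(n\in\mathbb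 N^m).$$ -/

import Mathlib

open MeasureTheory

noncomputable section

/-! ### The space `H²(β)` of formal power series -/

/-- The square-summability condition `∑ |a_n|² β_n² < ∞` on a formal power series `∑ a_n zⁿ`,
for a family of positive numbers `β_n`, `n ∈ ℕᵐ`. -/
def MemH2 {m : ℕ} (β : (Fin m →₀ ℕ) → Set.Ioi (0 : ℝ)) (f : MvPowerSeries (Fin m) ℂ) : Prop :=
  Summable fun n : Fin m →₀ ℕ => ‖MvPowerSeries.coeff n f‖ ^ 2 * (β n : ℝ) ^ 2

/-- The family `(β_n a_n)`, which is in `ℓ²` exactly when `f ∈ H²(β)`. -/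
def weightedCoeff {m : ℕ} (β : (Fin m →₀ ℕ) → Set.Ioi (0 : ℝ)) :
    MvPowerSeries (Fin m) ℂ →ₗ[ℂ] ((Fin m →₀ ℕ) → ℂ) where
  toFun f := fun n => ((β n : ℝ) : ℂ) * MvPowerSeries.coeff n f
  map_add' f g := by
    funext n
    simp only [map_add, mul_add]
    rfl
  map_smul' c f := by
    funext n
    simp only [MvPowerSeries.coeff_smul, RingHom.id_apply]
    exact mul_left_comm _ _ _

theorem memlp_weightedCoeff_iff {m : ℕ} (β : (Fin m →₀ ℕ) → Set.Ioi (0 : ℝ))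
    (f : MvPowerSeries (Fin m) ℂ) : Memℓp (weightedCoeff β f) 2 ↔ MemH2 β f := by
  rw [memℓp_gen_iff (by norm_num)]
  unfold MemH2
  refine summable_congr fun n => ?_
  have h : 0 < (β n : ℝ) := (β n).2
  simp [weightedCoeff, abs_of_pos h, mul_pow, mul_comm]

/-- `H²(β)` as a linear subspace of the space of formal power series. -/
def H2Submodule {m : ℕ} (β : (Fin m →₀ ℕ) → Set.Ioi (0 : ℝ)) :
    Submodule ℂ (MvPowerSeries (Fin m) ℂ) where
  carrier := {f | MemH2 β f}
  zero_mem' := by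
    change MemH2 β 0
    simp [MemH2, summable_zero]
  add_mem' {f g} hf hg := by
    have hf' := (memlp_weightedCoeff_iff β f).2 hf
    have hg' := (memlp_weightedCoeff_iff β g).2 hg
    change MemH2 β (f + g)
    rw [← memlp_weightedCoeff_iff, map_add]
    exact hf'.add hg'
  smul_mem' c f hf := by
    have hf' := (memlp_weightedCoeff_iff β f).2 hf
    change MemH2 β (c • f)
    rw [← memlp_weightedCoeff_iff, map_smul]
    exact hf'.const_smul c

/-- The Hilbert space `H²(β)` of formal power series. -/
def H2 {m : ℕ} (β : (Fin m →₀ ℕ) → Set.Ioi (0 : ℝ)) : Type := H2Submodule β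

namespace H2

variable {m : ℕ} (β : (Fin m →₀ ℕ) → Set.Ioi (0 : ℝ))

instance : AddCommGroup (H2 β) := inferInstanceAs (AddCommGroup (H2Submodule β))

instance : Module ℂ (H2 β) := inferInstanceAs (Module ℂ (H2Submodule β))

variable {β} in
/-- The formal power series underlying an element of `H²(β)`. -/
def toSeries : H2 β →ₗ[ℂ] MvPowerSeries (Fin m) ℂ := (H2Submodule β).subtype

variable {β} in
/-- The coefficient `a_n` of `f = ∑ a_n zⁿ ∈ H²(β)`. -/
def coeff (n : Fin m →₀ ℕ) (f : H2 β) : ℂ := MvPowerSeries.coeff n (toSeries f)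

/-- The linear bijection `f ↦ (β_n a_n)` from `H²(β)` onto `ℓ²(ℕᵐ)`. -/
def toLp : H2 β ≃ₗ[ℂ] lp (fun _ : Fin m →₀ ℕ => ℂ) 2 where
  toFun f := ⟨weightedCoeff β (toSeries f), (memlp_weightedCoeff_iff β _).2 f.2⟩
  map_add' f g := by
    apply Subtype.ext
    exact (congrArg (weightedCoeff β) (map_add toSeries f g)).trans (map_add _ _ _)
  map_smul' c f := by
    apply Subtype.ext
    exact (congrArg (weightedCoeff β) (map_smul toSeries c f)).trans (map_smul _ _ _)
  invFun a := ⟨fun n => ((β n : ℝ) : ℂ)⁻¹ * a n, by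
    refine (memlp_weightedCoeff_iff β _).1 ?_
    have : weightedCoeff β (fun n => ((β n : ℝ) : ℂ)⁻¹ * a n) = a := by
      funext n
      have h : ((β n : ℝ) : ℂ) ≠ 0 := by exact_mod_cast (ne_of_gt (β n).2)
      exact mul_inv_cancel_left₀ h _
    rw [this]
    exact a.2⟩
  left_inv f := by
    apply Subtype.ext
    funext n
    have h : ((β n : ℝ) : ℂ) ≠ 0 := by exact_mod_cast (ne_of_gt (β n).2)
    exact inv_mul_cancel_left₀ h _
  right_inv a := by
    apply Subtype.ext
    funext n
    have h : ((β n : ℝ) : ℂ) ≠ 0 := by exact_mod_cast (ne_of_gt (β n).2)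
    exact mul_inv_cancel_left₀ h _

/-- The scalar product `⟨f, g⟩ = ∑ β_n² conj(a_n) b_n` of `f = ∑ a_n zⁿ` and `g = ∑ b_n zⁿ`
(conjugate-linear in the first variable). -/
instance : Inner ℂ (H2 β) where
  inner f g := ∑' n, (((β n : ℝ) ^ 2 : ℝ) : ℂ) * (starRingEnd ℂ (coeff n f) * coeff n g)

theorem inner_toLp (f g : H2 β) : inner ℂ f g = inner ℂ (toLp β f) (toLp β g) := by
  rw [lp.inner_eq_tsum]
  refine tsum_congr fun n => ?_
  change _ = (((β n : ℝ) : ℂ) * coeff n g) * starRingEnd ℂ (((β n : ℝ) : ℂ) * coeff n f)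
  simp only [map_mul, Complex.conj_ofReal, Complex.ofReal_pow]
  ring

/-- The scalar product above satisfies the axioms of a scalar product. -/
@[reducible] def core : InnerProductSpace.Core ℂ (H2 β) where
  toInner := inferInstance
  conj_inner_symm f g := by
    rw [inner_toLp, inner_toLp]
    exact inner_conj_symm _ _
  re_inner_nonneg f := by
    rw [inner_toLp]
    exact inner_self_nonneg
  add_left f g h := by
    rw [inner_toLp, inner_toLp, inner_toLp, map_add]
    exact inner_add_left _ _ _
  smul_left f g c := by
    rw [inner_toLp, inner_toLp, map_smul]
    exact inner_smul_left _ _ _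
  definite f hf := by
    rw [inner_toLp] at hf
    exact (toLp β).map_eq_zero_iff.1 (inner_self_eq_zero.1 hf)

instance : NormedAddCommGroup (H2 β) := (core β).toNormedAddCommGroup

instance : InnerProductSpace ℂ (H2 β) := InnerProductSpace.ofCore (core β).toCore

instance : CompleteSpace (H2 β) := by
  have h : Isometry (toLp β) := by
    refine AddMonoidHomClass.isometry_of_norm _ fun f => ?_
    rw [@norm_eq_sqrt_re_inner ℂ, @norm_eq_sqrt_re_inner ℂ, inner_toLp]
  exact (IsometryEquiv.mk (toLp β).toEquiv h).completeSpace

/-- `‖f‖²_β = ∑ |a_n|² β_n²`. -/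
theorem norm_sq_eq (f : H2 β) : ‖f‖ ^ 2 = ∑' n, ‖coeff n f‖ ^ 2 * (β n : ℝ) ^ 2 := by
  rw [@norm_sq_eq_re_inner ℂ]
  change RCLike.re (∑' n, (((β n : ℝ) ^ 2 : ℝ) : ℂ) * (starRingEnd ℂ (coeff n f) * coeff n f)) = _
  have : ∀ n, (((β n : ℝ) ^ 2 : ℝ) : ℂ) * (starRingEnd ℂ (coeff n f) * coeff n f) =
      ((‖coeff n f‖ ^ 2 * (β n : ℝ) ^ 2 : ℝ) : ℂ) := by
    intro n
    rw [Complex.conj_mul']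
    push_cast
    ring
  simp_rw [this]
  rw [← Complex.ofReal_tsum]
  exact Complex.ofReal_re _

end H2

/-- `M = (M_{z_1}, …, M_{z_m})` is the (bounded) multiplication `m`-tuple on `H²(β)`: the `M j` are
bounded operators on `H²(β)`, and `M j` is multiplication by the coordinate function `z_j`. -/
def IsMultiplicationTuple {m : ℕ} (β : (Fin m →₀ ℕ) → Set.Ioi (0 : ℝ))
    (M : Fin m → H2 β →L[ℂ] H2 β) : Prop :=
  ∀ j f, H2.toSeries (M j f) = MvPowerSeries.X j * H2.toSeries f

/-! ### Operator tuples -/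

/-- An `m`-tuple `T` of commuting bounded operators on an infinite dimensional Hilbert space is
spherical if for each unitary matrix `U = (u_jk)` there is a unitary operator `Γ` such that
`Γ T_j = (∑_k u_jk T_k) Γ` for all `j`. -/
structure IsSpherical {m : ℕ} {H : Type*} [NormedAddCommGroup H] [InnerProductSpace ℂ H]
    [CompleteSpace H] (T : Fin m → H →L[ℂ] H) : Prop where
  infinite_dimensional : ¬ FiniteDimensional ℂ H
  commute : ∀ i j, Commute (T i) (T j)
  exists_unitary : ∀ U ∈ Matrix.unitaryGroup (Fin m) ℂ, ∃ Γ : H ≃ₗᵢ[ℂ] H,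
    ∀ j h, Γ (T j h) = (∑ k, U j k • T k) (Γ h)

/-- Unitary equivalence of two tuples of bounded operators. -/
def UnitarilyEquivalent {m : ℕ} {H K : Type*} [NormedAddCommGroup H] [InnerProductSpace ℂ H]
    [NormedAddCommGroup K] [InnerProductSpace ℂ K]
    (S : Fin m → H →L[ℂ] H) (T : Fin m → K →L[ℂ] K) : Prop :=
  ∃ V : H ≃ₗᵢ[ℂ] K, ∀ j h, V (S j h) = T j (V h)

/-- `T` is the (bounded, commuting) `m`-variable weighted shift with the positive weights
`w j n = w^{(j)}_n` with respect to the orthonormal basis `(e_n)`, `n ∈ ℕᵐ`: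
`T_j e_n = w^{(j)}_n e_{n + ε_j}`. -/
structure IsWeightedShift {m : ℕ} {K : Type*} [NormedAddCommGroup K] [InnerProductSpace ℂ K]
    (e : HilbertBasis (Fin m →₀ ℕ) ℂ K) (w : Fin m → (Fin m →₀ ℕ) → ℝ)
    (T : Fin m → K →L[ℂ] K) : Prop where
  weight_pos : ∀ j n, 0 < w j n
  commute : ∀ i j, Commute (T i) (T j)
  apply_basis : ∀ j n, T j (e n) = (w j n : ℂ) • e (n + Finsupp.single j 1)

/-! ### The unit sphere -/

/-- The unit sphere `∂𝔹` of `ℂᵐ`. -/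
abbrev UnitSphere (m : ℕ) : Type := Metric.sphere (0 : EuclideanSpace ℂ (Fin m)) 1

/-- The normalized surface area measure `σ` on `∂𝔹`. -/
def sphereMeasure (m : ℕ) : Measure (UnitSphere m) :=
  ((volume : Measure (EuclideanSpace ℂ (Fin m))).toSphere Set.univ)⁻¹ •
    (volume : Measure (EuclideanSpace ℂ (Fin m))).toSphere

/-- `‖p‖²_{L²(∂𝔹)} = ∫ |p|² dσ` for a polynomial `p`. -/
def sphereNormSq {m : ℕ} (p : MvPolynomial (Fin m) ℂ) : ℝ :=
  ∫ z : UnitSphere m, ‖MvPolynomial.eval (fun i => z.1 i) p‖ ^ 2 ∂(sphereMeasure m)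

/-- The homogeneous part `f_[k] = ∑_{|n| = k} a_n zⁿ` of a formal power series `f = ∑ a_n zⁿ`. -/
def homogeneousPart {m : ℕ} (k : ℕ) (f : MvPowerSeries (Fin m) ℂ) : MvPolynomial (Fin m) ℂ :=
  ∑ n ∈ (Finset.univ : Finset (Fin m)).finsuppAntidiag k,
    MvPolynomial.monomial n (MvPowerSeries.coeff n f)

/-- `b` is a sequence of positive numbers, and
`‖f‖²_β = ∑_k b_k² ‖f_[k]‖²_{L²(∂𝔹)}` for all `f ∈ H²(β)`. -/
structure IsScalarWeight {m : ℕ} (β : (Fin m →₀ ℕ) → Set.Ioi (0 : ℝ)) (b : ℕ → ℝ) : Prop where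
  pos : ∀ k, 0 < b k
  hasSum_norm_sq : ∀ f : H2 β,
    HasSum (fun k => b k ^ 2 * sphereNormSq (homogeneousPart k (H2.toSeries f))) (‖f‖ ^ 2)

end

noncomputable section

/-! The bridge between `β` and the sphere is that monomials are orthogonal in `L²(∂𝔹)`, with `‖zⁿ‖²
= (m-1)! n! / (m-1+|n|)!` (`integral_sphereMeasure_monomials`). Testing (1) on monomials, and
conversely summing over each degree, shows that (1) says exactly `β_n² = b_|n|² ‖zⁿ‖²`
(`isScalarWeight_iff`). The formula for `β_n` follows. The weights `β_{n+ε_i} / β_n` of `M_z` in the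
normalized monomials `zⁿ / β_n` then become the stated ones.

If (1) holds, the substitution `f ↦ f(Uz)` preserves degrees and, by unitary invariance, the sphere
norm of each homogeneous part (`sphereNormSq_linearSubst`). It is therefore a unitary operator on
`H²(β)`, and it satisfies the intertwining relation.

Conversely, let `Γ` be an intertwiner for `U`. The constants are the orthogonal complement of the
ranges of the `M_{z_j}`, so `Γ 1 = c` with `|c| = 1`, and hence `Γ p = c p(Uz)` for polynomials.
Thus all unitary substitutions are isometric on polynomials (`IsSpherical.norm_linearSubst`).
Rotations in a coordinate plane, applied to a monomial free of one of the two variables, give a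
polynomial identity whose coefficients force `β_n² / n!` to depend on `|n|` only
(`IsSpherical.sq_div_prod_factorial`). -/

/-! ### Gaussian integrals of homogeneous functions and monomials. -/

/-- Polar coordinates for the Gaussian integral of a positively homogeneous function. -/
theorem integral_gaussian_mul_of_homogeneous {𝕜 E : Type*} [RCLike 𝕜] [NormedAddCommGroup E]
    [NormedSpace ℝ E] [Nontrivial E] [FiniteDimensional ℝ E] [MeasurableSpace E] [BorelSpace E]
    (μ : Measure E) [μ.IsAddHaarMeasure] {d : ℕ} (f : E → 𝕜)
    (hf : ∀ r : ℝ, 0 < r → ∀ z, f (r • z) = ((r ^ d : ℝ) : 𝕜) * f z) :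
    ∫ z, ((Real.exp (-‖z‖ ^ 2) : ℝ) : 𝕜) * f z ∂μ =
      (∫ z, f z ∂μ.toSphere) *
        ((∫ r in Set.Ioi (0 : ℝ),
          r ^ (Module.finrank ℝ E - 1) * (r ^ d * Real.exp (-r ^ 2)) : ℝ) : 𝕜) := by
  have hpolar (u : Metric.sphere (0 : E) 1) (r : Set.Ioi (0 : ℝ)) :
      ((Real.exp (-‖(r : ℝ) • (u : E)‖ ^ 2) : ℝ) : 𝕜) * f ((r : ℝ) • (u : E)) =
        f u * ((((r : ℝ) ^ d * Real.exp (-(r : ℝ) ^ 2) : ℝ)) : 𝕜) := by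
    have hu : ‖(u : E)‖ = 1 := by simp
    rw [hf _ r.2, norm_smul, hu, Real.norm_of_nonneg (le_of_lt r.2)]
    push_cast
    ring_nf
  calc
    _ = ∫ z : ({(0)}ᶜ : Set E), ((Real.exp (-‖(z : E)‖ ^ 2) : ℝ) : 𝕜) * f z
          ∂(μ.comap (↑)) := by
      rw [integral_subtype_comap (measurableSet_singleton _).compl
        fun z ↦ ((Real.exp (-‖z‖ ^ 2) : ℝ) : 𝕜) * f z, restrict_compl_singleton]
    _ = ∫ x : Metric.sphere (0 : E) 1 × Set.Ioi (0 : ℝ),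
          f x.1 * ((((x.2 : ℝ) ^ d * Real.exp (-(x.2 : ℝ) ^ 2) : ℝ)) : 𝕜)
          ∂μ.toSphere.prod (.volumeIoiPow (Module.finrank ℝ E - 1)) := by
      have := (μ.measurePreserving_homeomorphUnitSphereProd).symm
        (homeomorphUnitSphereProd E).toMeasurableEquiv |>.integral_comp
        (homeomorphUnitSphereProd E).toMeasurableEquiv.symm.measurableEmbedding
        (fun z : ({(0)}ᶜ : Set E) ↦ ((Real.exp (-‖(z : E)‖ ^ 2) : ℝ) : 𝕜) * f z)
      rw [← this]
      refine integral_congr_ae (.of_forall fun x ↦ ?_)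
      exact hpolar x.1 x.2
    _ = _ := by
      rw [integral_prod_mul (fun u : Metric.sphere (0 : E) 1 ↦ f u)
        (fun r : Set.Ioi (0 : ℝ) ↦ ((((r : ℝ) ^ d * Real.exp (-(r : ℝ) ^ 2) : ℝ)) : 𝕜)),
        integral_ofReal]
      congr 2
      simp only [Measure.volumeIoiPow, ENNReal.ofReal]
      rw [integral_withDensity_eq_integral_smul,
        integral_subtype_comap measurableSet_Ioi fun a : ℝ ↦
          Real.toNNReal (a ^ (Module.finrank ℝ E - 1)) • (a ^ d * Real.exp (-a ^ 2)),
        setIntegral_congr_fun measurableSet_Ioi fun x hx ↦ ?_]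
      · rw [NNReal.smul_def, Real.coe_toNNReal _ (pow_nonneg hx.out.le _), smul_eq_mul]
      · exact (measurable_subtype_coe.pow_const _).real_toNNReal

theorem integral_Ioi_pow_mul_pow_mul_exp_neg_sq (a d : ℕ) :
    ∫ r in Set.Ioi (0 : ℝ), r ^ a * (r ^ d * Real.exp (-r ^ 2)) =
      1 / 2 * Real.Gamma (((a + d : ℕ) + 1 : ℝ) / 2) := by
  rw [← integral_rpow_mul_exp_neg_rpow (p := 2) (q := (a + d : ℕ)) two_pos
    (by linarith [(Nat.cast_nonneg (a + d) : (0 : ℝ) ≤ _)])]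
  refine setIntegral_congr_fun measurableSet_Ioi fun x hx ↦ ?_
  simp only [Real.rpow_natCast, Real.rpow_two]
  ring

/-- On the diagonal this is a radial Gamma integral. Off the diagonal, rotating the plane by `w`
multiplies the integral by `w ^ (a - b)`, which forces it to vanish. -/
theorem Complex.integral_gaussian_mul_pow_mul_conj_pow (a b : ℕ) :
    ∫ z : ℂ, ((Real.exp (-‖z‖ ^ 2) : ℝ) : ℂ) * (z ^ a * (starRingEnd ℂ z) ^ b) =
      if a = b then (Real.pi : ℂ) * a.factorial else 0 := by
  split_ifs with h
  · subst h
    have key := Complex.integral_rpow_mul_exp_neg_rpow (p := 2) (q := (2 * a : ℕ)) one_le_two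
      (by linarith [(Nat.cast_nonneg (2 * a) : (0 : ℝ) ≤ _)])
    have h2 : (((2 * a : ℕ) : ℝ) + 2) / 2 = (a : ℝ) + 1 := by push_cast; ring
    rw [h2, Real.Gamma_nat_eq_factorial] at key
    have : ∀ z : ℂ, ((Real.exp (-‖z‖ ^ 2) : ℝ) : ℂ) * (z ^ a * (starRingEnd ℂ z) ^ a) =
        ((‖z‖ ^ ((2 * a : ℕ) : ℝ) * Real.exp (-‖z‖ ^ (2 : ℝ)) : ℝ) : ℂ) := by
      intro z
      rw [← mul_pow, Complex.mul_conj', Real.rpow_natCast, Real.rpow_two]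
      push_cast
      ring
    simp_rw [this]
    rw [integral_complex_ofReal, key]
    push_cast
    ring
  · set I := ∫ z : ℂ, ((Real.exp (-‖z‖ ^ 2) : ℝ) : ℂ) * (z ^ a * (starRingEnd ℂ z) ^ b) with hI
    have hrot (w : Circle) : I = ((w : ℂ) ^ a * (starRingEnd ℂ (w : ℂ)) ^ b) * I := by
      have := (rotation w).measurePreserving.integral_comp
        (rotation w).toHomeomorph.measurableEmbedding
        (fun z : ℂ ↦ ((Real.exp (-‖z‖ ^ 2) : ℝ) : ℂ) * (z ^ a * (starRingEnd ℂ z) ^ b))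
      rw [← hI] at this
      conv_lhs => rw [← this]
      rw [hI, ← integral_const_mul]
      refine integral_congr_ae (.of_forall fun z ↦ ?_)
      simp only [rotation_apply, norm_mul, Circle.norm_coe, one_mul, map_mul]
      ring
    have hab : ((a : ℝ) - b) ≠ 0 := sub_ne_zero.2 (by exact_mod_cast h)
    -- This angle is chosen so that `w ^ (a - b) = exp (π i) = -1`, whence `I = -I`.
    have h1 := hrot (Circle.exp (Real.pi / ((a : ℝ) - b)))
    have h2 : ((Circle.exp (Real.pi / ((a : ℝ) - b)) : ℂ)) ^ a *
        (starRingEnd ℂ (Circle.exp (Real.pi / ((a : ℝ) - b)) : ℂ)) ^ b = -1 := by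
      rw [← Circle.coe_inv_eq_conj, ← Circle.exp_neg, Circle.coe_exp, Circle.coe_exp,
        ← Complex.exp_nat_mul, ← Complex.exp_nat_mul, ← Complex.exp_add, ← Complex.exp_pi_mul_I]
      congr 1
      have : ((a : ℂ) - b) ≠ 0 := by exact_mod_cast hab
      push_cast
      field_simp
      ring
    rw [h2] at h1
    linear_combination h1 / 2

/-- The Gaussian factors over the coordinates. Euclidean volume is only used as some Haar multiple
of the product measure. The resulting `C` is the total Gaussian mass and later cancels, so only `C ≠
0` is recorded. -/
theorem integral_gaussian_mul_monomials (m : ℕ) :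
    ∃ C : ℝ, C ≠ 0 ∧ ∀ n l : Fin m →₀ ℕ,
      ∫ z : EuclideanSpace ℂ (Fin m), ((Real.exp (-‖z‖ ^ 2) : ℝ) : ℂ) *
        ((∏ i, z i ^ n i) * starRingEnd ℂ (∏ i, z i ^ l i)) =
      if n = l then (C : ℂ) * ∏ i, ((n i).factorial : ℂ) else 0 := by
  let T : EuclideanSpace ℂ (Fin m) ≃L[ℝ] (Fin m → ℂ) :=
    PiLp.continuousLinearEquiv 2 ℝ (fun _ : Fin m ↦ ℂ)
  let ν : Measure (Fin m → ℂ) := (volume : Measure (EuclideanSpace ℂ (Fin m))).map T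
  have : ν.IsAddHaarMeasure := T.isAddHaarMeasure_map volume
  have hν := Measure.isAddLeftInvariant_eq_smul ν (volume : Measure (Fin m → ℂ))
  set c := ν.addHaarScalarFactor (volume : Measure (Fin m → ℂ))
  have hc0 : c ≠ 0 := (Measure.addHaarScalarFactor_pos_of_isAddHaarMeasure _ _).ne'
  refine ⟨c * Real.pi ^ m, mul_ne_zero (by exact_mod_cast hc0) (pow_ne_zero _ Real.pi_ne_zero),
    fun n l ↦ ?_⟩
  have key : ∫ x : Fin m → ℂ, ∏ i, ((Real.exp (-‖x i‖ ^ 2) : ℝ) : ℂ) *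
      (x i ^ n i * (starRingEnd ℂ (x i)) ^ l i) =
      ∏ i, if n i = l i then (Real.pi : ℂ) * (n i).factorial else 0 := by
    rw [integral_fintype_prod_volume_eq_prod fun i (z : ℂ) ↦ ((Real.exp (-‖z‖ ^ 2) : ℝ) : ℂ) *
      (z ^ n i * (starRingEnd ℂ z) ^ l i)]
    simp_rw [Complex.integral_gaussian_mul_pow_mul_conj_pow]
  calc
    _ = ∫ z : EuclideanSpace ℂ (Fin m), ∏ i, ((Real.exp (-‖T z i‖ ^ 2) : ℝ) : ℂ) *
          (T z i ^ n i * (starRingEnd ℂ (T z i)) ^ l i) := by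
      refine integral_congr_ae (.of_forall fun z ↦ ?_)
      simp only [T, PiLp.coe_continuousLinearEquiv, EuclideanSpace.norm_sq_eq,
        Finset.prod_mul_distrib, map_prod, map_pow]
      rw [← Finset.sum_neg_distrib, Real.exp_sum]
      push_cast
      rfl
    _ = ∫ x : Fin m → ℂ, ∏ i, ((Real.exp (-‖x i‖ ^ 2) : ℝ) : ℂ) *
          (x i ^ n i * (starRingEnd ℂ (x i)) ^ l i) ∂ν := by
      exact (T.toHomeomorph.measurableEmbedding.integral_map fun x : Fin m → ℂ ↦
        ∏ i, ((Real.exp (-‖x i‖ ^ 2) : ℝ) : ℂ) *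
          (x i ^ n i * (starRingEnd ℂ (x i)) ^ l i)).symm
    _ = _ := by
      rw [hν, integral_smul_nnreal_measure, key]
      split_ifs with h
      · subst h
        simp [Finset.prod_mul_distrib, NNReal.smul_def, mul_assoc]
      · obtain ⟨i, hi⟩ : ∃ i, n i ≠ l i := by
          by_contra! h'
          exact h (Finsupp.ext h')
        rw [Finset.prod_eq_zero (Finset.mem_univ i) (if_neg hi), smul_zero]

/-! ### Monomials in `L²(∂𝔹)`. -/

/-- `‖zⁿ‖²` in `L²(∂𝔹)`. -/
def monomialNormSq {m : ℕ} (n : Fin m →₀ ℕ) : ℝ :=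
  (((m - 1).factorial : ℝ) * ∏ i, ((n i).factorial : ℝ)) / ((m - 1 + n.degree).factorial : ℝ)

theorem monomialNormSq_pos {m : ℕ} (n : Fin m →₀ ℕ) : 0 < monomialNormSq n := by
  unfold monomialNormSq
  have : 0 < ∏ i, ((n i).factorial : ℝ) :=
    Finset.prod_pos fun i _ ↦ by exact_mod_cast Nat.factorial_pos _
  positivity

/-- Polar coordinates are applied to `f` and to the constant `1`. The radial integrals are
`(m-1+k)!/2` and `(m-1)!/2`, and the total surface area cancels against the normalization. The
scalar field is left general because both complex moments and real squared moduli are needed. -/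
theorem integral_sphereMeasure_of_homogeneous {𝕜 : Type*} [RCLike 𝕜] {m : ℕ} (hm : 1 ≤ m) {k : ℕ}
    (f : EuclideanSpace ℂ (Fin m) → 𝕜)
    (hf : ∀ r : ℝ, 0 < r → ∀ z, f (r • z) = ((r ^ (2 * k) : ℝ) : 𝕜) * f z) :
    (∫ z : EuclideanSpace ℂ (Fin m), ((Real.exp (-‖z‖ ^ 2) : ℝ) : 𝕜)) *
      ((((m - 1 + k).factorial : ℝ) : 𝕜) * ∫ z : UnitSphere m, f z ∂(sphereMeasure m)) =
    (((m - 1).factorial : ℝ) : 𝕜) *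
      ∫ z : EuclideanSpace ℂ (Fin m), ((Real.exp (-‖z‖ ^ 2) : ℝ) : 𝕜) * f z := by
  have : NeZero m := ⟨by omega⟩
  have hdim : Module.finrank ℝ (EuclideanSpace ℂ (Fin m)) = 2 * m := by
    rw [finrank_real_of_complex, finrank_euclideanSpace_fin]
  have hJ (j : ℕ) : ∫ r in Set.Ioi (0 : ℝ),
      r ^ (Module.finrank ℝ (EuclideanSpace ℂ (Fin m)) - 1) * (r ^ (2 * j) * Real.exp (-r ^ 2)) =
      1 / 2 * ((m - 1 + j).factorial : ℝ) := by
    rw [integral_Ioi_pow_mul_pow_mul_exp_neg_sq, hdim, ← Real.Gamma_nat_eq_factorial]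
    congr 2
    obtain ⟨p, rfl⟩ : ∃ p, m = p + 1 := ⟨m - 1, by omega⟩
    have : 2 * (p + 1) - 1 + 2 * j = 2 * p + 1 + 2 * j := by omega
    rw [this]
    push_cast [Nat.add_sub_cancel]
    ring
  -- The degree is written `2 * 0` so that `hJ` applies to it with `j = 0`.
  have h1 := integral_gaussian_mul_of_homogeneous (𝕜 := 𝕜)
    (volume : Measure (EuclideanSpace ℂ (Fin m))) (d := 2 * 0) (fun _ ↦ 1) (by simp)
  have h2 := integral_gaussian_mul_of_homogeneous
    (volume : Measure (EuclideanSpace ℂ (Fin m))) f hf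
  rw [hJ] at h1 h2
  simp only [mul_one, integral_const, add_zero] at h1
  rw [h1, h2, sphereMeasure, integral_smul_measure]
  set s := (volume : Measure (EuclideanSpace ℂ (Fin m))).toSphere
  have hs0 : s Set.univ ≠ 0 := by
    rw [Ne, Measure.measure_univ_eq_zero]
    exact Measure.toSphere_ne_zero _
  have hs1 : s.real Set.univ ≠ 0 := by
    rw [measureReal_def, ENNReal.toReal_ne_zero]
    exact ⟨hs0, measure_ne_top _ _⟩
  rw [ENNReal.toReal_inv, ← measureReal_def]
  have hs2 : ((s.real Set.univ : ℝ) : 𝕜) ≠ 0 := by exact_mod_cast hs1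
  simp only [RCLike.real_smul_eq_coe_mul]
  push_cast
  field_simp

theorem prod_pow_smul {m : ℕ} (n : Fin m →₀ ℕ) (r : ℝ) (z : EuclideanSpace ℂ (Fin m)) :
    ∏ i, (r • z) i ^ n i = (r : ℂ) ^ n.degree * ∏ i, z i ^ n i := by
  simp [mul_pow, Finset.prod_mul_distrib, Finset.prod_pow_eq_pow_sum, Finsupp.degree_eq_sum]

theorem integral_sphereMeasure_monomials {m : ℕ} (hm : 1 ≤ m) {k : ℕ} (n l : Fin m →₀ ℕ)
    (hn : n.degree = k) (hl : l.degree = k) :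
    ∫ z : UnitSphere m, (∏ i, z.1 i ^ n i) * starRingEnd ℂ (∏ i, z.1 i ^ l i)
      ∂(sphereMeasure m) = if n = l then (monomialNormSq n : ℂ) else 0 := by
  obtain ⟨C, hC, hG⟩ := integral_gaussian_mul_monomials m
  -- The moment with `n = l = 0` identifies `C` as the total Gaussian mass.
  have h0 := hG 0 0
  simp only [Finsupp.coe_zero, Pi.zero_apply, pow_zero, Finset.prod_const_one, map_one, mul_one,
    Nat.factorial_zero, Nat.cast_one, if_true] at h0
  have h : (∫ z : EuclideanSpace ℂ (Fin m), ((Real.exp (-‖z‖ ^ 2) : ℝ) : ℂ)) *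
      ((((m - 1 + k).factorial : ℝ) : ℂ) * ∫ z : UnitSphere m,
        (∏ i, z.1 i ^ n i) * starRingEnd ℂ (∏ i, z.1 i ^ l i) ∂(sphereMeasure m)) =
      (((m - 1).factorial : ℝ) : ℂ) * ∫ z : EuclideanSpace ℂ (Fin m),
        ((Real.exp (-‖z‖ ^ 2) : ℝ) : ℂ) *
          ((∏ i, z i ^ n i) * starRingEnd ℂ (∏ i, z i ^ l i)) :=
    integral_sphereMeasure_of_homogeneous hm (k := k)
    (fun z ↦ (∏ i, z i ^ n i) * starRingEnd ℂ (∏ i, z i ^ l i)) (fun r _ z ↦ by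
      rw [prod_pow_smul, prod_pow_smul, hn, hl]
      simp
      ring)
  rw [hG n l, h0] at h
  have hC' : (C : ℂ) ≠ 0 := by exact_mod_cast hC
  have hf : ((m - 1 + k).factorial : ℂ) ≠ 0 := by exact_mod_cast Nat.factorial_ne_zero _
  split_ifs at h ⊢ with hnl
  · rw [monomialNormSq, hn]
    push_cast at h ⊢
    rw [eq_div_iff hf]
    refine mul_left_cancel₀ hC' ?_
    linear_combination h
  · simp only [mul_zero, mul_eq_zero] at h
    have hf' : (((m - 1 + k).factorial : ℝ) : ℂ) ≠ 0 := by exact_mod_cast Nat.factorial_ne_zero _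
    exact (h.resolve_left hC').resolve_left hf'

theorem integrable_sphereMeasure_of_continuous {m : ℕ} (hm : 1 ≤ m) {f : UnitSphere m → ℂ}
    (hf : Continuous f) : Integrable f (sphereMeasure m) := by
  have : NeZero m := ⟨by omega⟩
  refine Integrable.smul_measure (hf.integrable_of_hasCompactSupport
    (HasCompactSupport.of_compactSpace f)) ?_
  rw [Ne, ENNReal.inv_eq_top, Measure.measure_univ_eq_zero]
  exact Measure.toSphere_ne_zero _

theorem mem_finsuppAntidiag_univ_iff {m : ℕ} {k : ℕ} {n : Fin m →₀ ℕ} :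
    n ∈ (Finset.univ : Finset (Fin m)).finsuppAntidiag k ↔ n.degree = k := by
  simp [Finset.mem_finsuppAntidiag, Finsupp.degree_eq_sum]

theorem eval_homogeneousPart {m : ℕ} (k : ℕ) (f : MvPowerSeries (Fin m) ℂ) (z : Fin m → ℂ) :
    MvPolynomial.eval z (homogeneousPart k f) =
      ∑ n ∈ (Finset.univ : Finset (Fin m)).finsuppAntidiag k,
        MvPowerSeries.coeff n f * ∏ i, z i ^ n i := by
  simp [homogeneousPart, MvPolynomial.eval_monomial, Finsupp.prod_fintype]

theorem sphereNormSq_homogeneousPart {m : ℕ} (hm : 1 ≤ m) (k : ℕ) (f : MvPowerSeries (Fin m) ℂ) :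
    sphereNormSq (homogeneousPart k f) =
      ∑ n ∈ (Finset.univ : Finset (Fin m)).finsuppAntidiag k,
        ‖MvPowerSeries.coeff n f‖ ^ 2 * monomialNormSq n := by
  set S := (Finset.univ : Finset (Fin m)).finsuppAntidiag k
  have hS {n : Fin m →₀ ℕ} (hn : n ∈ S) : n.degree = k := mem_finsuppAntidiag_univ_iff.1 hn
  -- The computation moves to `ℂ` because expanding `|f_[k]|²` produces complex cross terms;
  -- orthogonality removes them.
  apply Complex.ofReal_injective
  rw [sphereNormSq, ← integral_complex_ofReal]
  have hexp (z : UnitSphere m) :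
      ((‖MvPolynomial.eval (fun i ↦ z.1 i) (homogeneousPart k f)‖ ^ 2 : ℝ) : ℂ) =
      ∑ n ∈ S, ∑ l ∈ S, (MvPowerSeries.coeff n f * starRingEnd ℂ (MvPowerSeries.coeff l f)) *
        ((∏ i, z.1 i ^ n i) * starRingEnd ℂ (∏ i, z.1 i ^ l i)) := by
    rw [Complex.ofReal_pow, ← Complex.mul_conj', eval_homogeneousPart, map_sum,
      Finset.sum_mul_sum]
    refine Finset.sum_congr rfl fun n _ ↦ Finset.sum_congr rfl fun l _ ↦ ?_
    rw [map_mul]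
    ring
  have hcont (n l : Fin m →₀ ℕ) : Continuous fun z : UnitSphere m ↦
      (MvPowerSeries.coeff n f * starRingEnd ℂ (MvPowerSeries.coeff l f)) *
        ((∏ i, z.1 i ^ n i) * starRingEnd ℂ (∏ i, z.1 i ^ l i)) := by
    simp only [map_prod, map_pow]
    have h (i : Fin m) : Continuous fun z : UnitSphere m ↦ z.1 i :=
      (EuclideanSpace.proj (𝕜 := ℂ) i).continuous.comp continuous_subtype_val
    have h' (i : Fin m) : Continuous fun z : UnitSphere m ↦ starRingEnd ℂ (z.1 i) :=
      Complex.continuous_conj.comp (h i)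
    fun_prop
  simp_rw [hexp]
  rw [integral_finsetSum _ fun n _ ↦ integrable_finsetSum _ fun l _ ↦
    integrable_sphereMeasure_of_continuous hm (hcont n l)]
  push_cast
  refine Finset.sum_congr rfl fun n hn ↦ ?_
  rw [integral_finsetSum _ fun l _ ↦ integrable_sphereMeasure_of_continuous hm (hcont n l)]
  rw [Finset.sum_eq_single_of_mem n hn]
  · rw [integral_const_mul, integral_sphereMeasure_monomials hm n n (hS hn) (hS hn), if_pos rfl,
      Complex.mul_conj']
  · intro l hl hne
    rw [integral_const_mul, integral_sphereMeasure_monomials hm n l (hS hn) (hS hl),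
      if_neg hne.symm, mul_zero]

/-! ### Linear substitutions in polynomials and unitary invariance of the sphere norm. -/

/-- The substitution `z_j ↦ ∑_k u_jk z_k` in polynomials. -/
def linearSubst {m : ℕ} (U : Matrix (Fin m) (Fin m) ℂ) :
    MvPolynomial (Fin m) ℂ →ₐ[ℂ] MvPolynomial (Fin m) ℂ :=
  MvPolynomial.aeval fun j ↦ ∑ k, U j k • MvPolynomial.X k

theorem linearSubst_X {m : ℕ} (U : Matrix (Fin m) (Fin m) ℂ) (j : Fin m) :
    linearSubst U (MvPolynomial.X j) = ∑ k, U j k • MvPolynomial.X k :=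
  MvPolynomial.aeval_X _ _

/-- The factors are reversed because the substitution is precomposition, `p ↦ p ∘ U`. -/
theorem linearSubst_linearSubst {m : ℕ} (U V : Matrix (Fin m) (Fin m) ℂ)
    (p : MvPolynomial (Fin m) ℂ) :
    linearSubst U (linearSubst V p) = linearSubst (V * U) p := by
  have : (linearSubst U).comp (linearSubst V) = linearSubst (V * U) := by
    refine MvPolynomial.algHom_ext fun j ↦ ?_
    simp only [AlgHom.comp_apply, linearSubst_X, map_sum, map_smul, Matrix.mul_apply,
      Finset.smul_sum, Finset.sum_smul, smul_smul]
    exact Finset.sum_comm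
  exact DFunLike.congr_fun this p

theorem linearSubst_one {m : ℕ} (p : MvPolynomial (Fin m) ℂ) : linearSubst 1 p = p := by
  have : linearSubst (1 : Matrix (Fin m) (Fin m) ℂ) = AlgHom.id ℂ _ := by
    refine MvPolynomial.algHom_ext fun j ↦ ?_
    simp [linearSubst_X, Matrix.one_apply]
  rw [this, AlgHom.id_apply]

theorem isHomogeneous_linearSubst {m : ℕ} (U : Matrix (Fin m) (Fin m) ℂ)
    {p : MvPolynomial (Fin m) ℂ} {k : ℕ} (hp : p.IsHomogeneous k) :
    (linearSubst U p).IsHomogeneous k := by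
  have h := hp.aeval (fun j ↦ ∑ k, U j k • MvPolynomial.X k) (n := 1) fun j ↦
    MvPolynomial.IsHomogeneous.sum _ _ _ fun i _ ↦ by
      rw [MvPolynomial.smul_eq_C_mul]
      exact (MvPolynomial.isHomogeneous_X _ _).C_mul _
  rwa [one_mul] at h

theorem eval_linearSubst {m : ℕ} (U : Matrix (Fin m) (Fin m) ℂ) (p : MvPolynomial (Fin m) ℂ)
    (z : Fin m → ℂ) :
    MvPolynomial.eval z (linearSubst U p) = MvPolynomial.eval (U.mulVec z) p := by
  have : ((MvPolynomial.aeval z).comp (linearSubst U) : MvPolynomial (Fin m) ℂ →ₐ[ℂ] ℂ) =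
      MvPolynomial.aeval (U.mulVec z) := by
    refine MvPolynomial.algHom_ext fun j ↦ ?_
    simp [linearSubst_X, Matrix.mulVec, dotProduct]
  simpa [MvPolynomial.coe_aeval_eq_eval] using DFunLike.congr_fun this p

/-- Invariance is obtained on the whole space, where a unitary map preserves both Lebesgue measure
and the Gaussian. Homogeneity then carries it to the sphere. -/
theorem sphereNormSq_linearSubst {m : ℕ} (hm : 1 ≤ m) {U : Matrix (Fin m) (Fin m) ℂ}
    (hU : U ∈ Matrix.unitaryGroup (Fin m) ℂ) {p : MvPolynomial (Fin m) ℂ} {k : ℕ}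
    (hp : p.IsHomogeneous k) : sphereNormSq (linearSubst U p) = sphereNormSq p := by
  have hhom {q : MvPolynomial (Fin m) ℂ} (hq : q.IsHomogeneous k) (r : ℝ) (_ : 0 < r)
      (z : EuclideanSpace ℂ (Fin m)) :
      ‖MvPolynomial.eval (fun i ↦ (r • z) i) q‖ ^ 2 =
        ((r ^ (2 * k) : ℝ) : ℝ) * ‖MvPolynomial.eval (fun i ↦ z i) q‖ ^ 2 := by
    have h : MvPolynomial.eval (fun i ↦ (r • z) i) q =
        (r : ℂ) ^ k * MvPolynomial.eval (fun i ↦ z i) q := by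
      rw [MvPolynomial.eval_eq', MvPolynomial.eval_eq', Finset.mul_sum]
      refine Finset.sum_congr rfl fun n hn ↦ ?_
      have hd : n.degree = k := by
        rw [Finsupp.degree_eq_weight_one]
        exact hq (MvPolynomial.mem_support_iff.1 hn)
      rw [prod_pow_smul, hd]
      ring
    rw [h, norm_mul, norm_pow, Complex.norm_real, mul_pow, ← pow_mul, Real.norm_eq_abs,
      mul_comm k 2, pow_mul, sq_abs, ← pow_mul]
  have h1 := integral_sphereMeasure_of_homogeneous (𝕜 := ℝ) hm
    (fun z ↦ ‖MvPolynomial.eval (fun i ↦ z i) p‖ ^ 2) (hhom hp)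
  have h2 := integral_sphereMeasure_of_homogeneous (𝕜 := ℝ) hm
    (fun z ↦ ‖MvPolynomial.eval (fun i ↦ z i) (linearSubst U p)‖ ^ 2)
    (hhom (isHomogeneous_linearSubst U hp))
  let Ψ : EuclideanSpace ℂ (Fin m) ≃ₗᵢ[ℂ] EuclideanSpace ℂ (Fin m) :=
    Unitary.linearIsometryEquiv ⟨Matrix.toEuclideanCLM (𝕜 := ℂ) U, Unitary.map_mem _ hU⟩
  let Φ : EuclideanSpace ℂ (Fin m) ≃ₗᵢ[ℝ] EuclideanSpace ℂ (Fin m) :=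
    { toLinearEquiv := Ψ.toLinearEquiv.restrictScalars ℝ
      norm_map' := Ψ.norm_map }
  have hΦ (z i) : Φ z i = U.mulVec (fun i ↦ z i) i := rfl
  have h3 : ∫ z : EuclideanSpace ℂ (Fin m), ((Real.exp (-‖z‖ ^ 2) : ℝ) : ℝ) *
        ‖MvPolynomial.eval (fun i ↦ z i) (linearSubst U p)‖ ^ 2 =
      ∫ z : EuclideanSpace ℂ (Fin m), ((Real.exp (-‖z‖ ^ 2) : ℝ) : ℝ) *
        ‖MvPolynomial.eval (fun i ↦ z i) p‖ ^ 2 := by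
    conv_rhs => rw [← Φ.measurePreserving.integral_comp Φ.toHomeomorph.measurableEmbedding]
    refine integral_congr_ae (.of_forall fun z ↦ ?_)
    simp only [LinearIsometryEquiv.norm_map, eval_linearSubst, hΦ]
  obtain ⟨C, hC, hG⟩ := integral_gaussian_mul_monomials m
  have h0 : ∫ z : EuclideanSpace ℂ (Fin m), Real.exp (-‖z‖ ^ 2) ≠ 0 := by
    have := hG 0 0
    simp only [Finsupp.coe_zero, Pi.zero_apply, pow_zero, Finset.prod_const_one, map_one, mul_one,
      Nat.factorial_zero, Nat.cast_one, if_true, integral_complex_ofReal] at this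
    rwa [Complex.ofReal_injective this]
  have hf : ((m - 1 + k).factorial : ℝ) ≠ 0 := by exact_mod_cast Nat.factorial_ne_zero _
  simp only [RCLike.ofReal_real_eq_id, id_eq] at h1 h2
  rw [h3, ← h1] at h2
  exact mul_left_cancel₀ hf (mul_left_cancel₀ h0 h2)

/-! ### Polynomials inside `H²(β)`. -/

namespace H2

variable {m : ℕ} {β : (Fin m →₀ ℕ) → Set.Ioi (0 : ℝ)}

theorem toSeries_injective : Function.Injective (toSeries : H2 β → MvPowerSeries (Fin m) ℂ) :=
  Subtype.val_injective

theorem ext_coeff {f g : H2 β} (h : ∀ n, coeff n f = coeff n g) : f = g :=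
  Subtype.ext (MvPowerSeries.ext h)

theorem coeff_smul (n : Fin m →₀ ℕ) (c : ℂ) (f : H2 β) : coeff n (c • f) = c * coeff n f := by
  simp [coeff]

theorem hasSum_norm_sq (f : H2 β) :
    HasSum (fun n ↦ ‖coeff n f‖ ^ 2 * (β n : ℝ) ^ 2) (‖f‖ ^ 2) := by
  have h : MemH2 β (toSeries f) := f.2
  rw [norm_sq_eq]
  exact Summable.hasSum h

theorem memH2_coe (p : MvPolynomial (Fin m) ℂ) : MemH2 β (p : MvPowerSeries (Fin m) ℂ) := by
  refine summable_of_ne_finset_zero (s := p.support) fun n hn ↦ ?_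
  rw [MvPolynomial.coeff_coe, MvPolynomial.notMem_support_iff.1 hn]
  simp

/-- A polynomial as an element of `H²(β)`. -/
def ofPolynomial (β : (Fin m →₀ ℕ) → Set.Ioi (0 : ℝ)) : MvPolynomial (Fin m) ℂ →ₗ[ℂ] H2 β where
  toFun p := ⟨p, memH2_coe p⟩
  map_add' p q := Subtype.ext (MvPolynomial.coe_add p q)
  map_smul' c p := Subtype.ext (MvPolynomial.coe_smul p c)

theorem toSeries_ofPolynomial (p : MvPolynomial (Fin m) ℂ) :
    toSeries (ofPolynomial β p) = (p : MvPowerSeries (Fin m) ℂ) := rfl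

theorem coeff_ofPolynomial (n : Fin m →₀ ℕ) (p : MvPolynomial (Fin m) ℂ) :
    coeff n (ofPolynomial β p) = MvPolynomial.coeff n p :=
  MvPolynomial.coeff_coe p n

theorem norm_sq_ofPolynomial (p : MvPolynomial (Fin m) ℂ) (s : Finset (Fin m →₀ ℕ))
    (hs : p.support ⊆ s) :
    ‖ofPolynomial β p‖ ^ 2 = ∑ n ∈ s, ‖MvPolynomial.coeff n p‖ ^ 2 * (β n : ℝ) ^ 2 := by
  rw [norm_sq_eq, tsum_eq_sum (s := s)]
  · simp only [coeff_ofPolynomial]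
  · intro n hn
    rw [coeff_ofPolynomial, MvPolynomial.notMem_support_iff.1 fun h ↦ hn (hs h)]
    simp

theorem norm_sq_ofPolynomial_monomial (n : Fin m →₀ ℕ) (c : ℂ) :
    ‖ofPolynomial β (MvPolynomial.monomial n c)‖ ^ 2 = ‖c‖ ^ 2 * (β n : ℝ) ^ 2 := by
  rw [norm_sq_ofPolynomial _ {n} MvPolynomial.support_monomial_subset]
  simp

theorem multiplication_ofPolynomial {M : Fin m → H2 β →L[ℂ] H2 β}
    (hM : IsMultiplicationTuple β M) (j : Fin m) (p : MvPolynomial (Fin m) ℂ) :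
    M j (ofPolynomial β p) = ofPolynomial β (MvPolynomial.X j * p) := by
  apply Subtype.ext
  change toSeries (M j (ofPolynomial β p)) = _
  rw [hM, toSeries_ofPolynomial, ← MvPolynomial.coe_X, ← MvPolynomial.coe_mul]
  rfl

end H2

theorem IsMultiplicationTuple.commute {m : ℕ} {β : (Fin m →₀ ℕ) → Set.Ioi (0 : ℝ)}
    {M : Fin m → H2 β →L[ℂ] H2 β} (hM : IsMultiplicationTuple β M) (i j : Fin m) :
    Commute (M i) (M j) := by
  refine ContinuousLinearMap.ext fun f ↦ Subtype.ext ?_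
  change H2.toSeries (M i (M j f)) = H2.toSeries (M j (M i f))
  rw [hM, hM, hM, hM, mul_left_comm]

theorem IsMultiplicationTuple.infinite_dimensional {m : ℕ} (hm : 1 ≤ m)
    (β : (Fin m →₀ ℕ) → Set.Ioi (0 : ℝ)) : ¬ FiniteDimensional ℂ (H2 β) := by
  intro h
  have hinj : Function.Injective (H2.ofPolynomial β) := fun p q hpq ↦
    MvPolynomial.coe_injective (Fin m) ℂ (congrArg H2.toSeries hpq)
  have hfin : Module.Finite ℂ (MvPolynomial (Fin m) ℂ) := Module.Finite.of_injective _ hinj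
  have : NeZero m := ⟨by omega⟩
  have hb := Module.Finite.finite_basis (MvPolynomial.basisMonomials (Fin m) ℂ)
  exact not_finite (Fin m →₀ ℕ)

/-! ### Condition (1) as a formula for `β`. -/

/-- Nonnegative families on `ℕᵐ` can be summed degree by degree. -/
theorem hasSum_degree_iff {m : ℕ} {g : (Fin m →₀ ℕ) → ℝ} (hg : ∀ n, 0 ≤ g n) {a : ℝ} :
    HasSum (fun k ↦ ∑ n ∈ (Finset.univ : Finset (Fin m)).finsuppAntidiag k, g n) a ↔
      HasSum g a := by
  have hfib (k : ℕ) : ∑' n : (Finsupp.degree : (Fin m →₀ ℕ) → ℕ) ⁻¹' {k}, g n =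
      ∑ n ∈ (Finset.univ : Finset (Fin m)).finsuppAntidiag k, g n := by
    have : (Finsupp.degree : (Fin m →₀ ℕ) → ℕ) ⁻¹' {k} =
        ((Finset.univ : Finset (Fin m)).finsuppAntidiag k : Set (Fin m →₀ ℕ)) := by
      ext n
      rw [SetLike.mem_coe, mem_finsuppAntidiag_univ_iff]
      rfl
    rw [this, Finset.tsum_subtype']
  have mp {a : ℝ} (h : HasSum g a) :
      HasSum (fun k ↦ ∑ n ∈ (Finset.univ : Finset (Fin m)).finsuppAntidiag k, g n) a := by
    simpa only [hfib] using h.tsum_fiberwise (Finsupp.degree : (Fin m →₀ ℕ) → ℕ)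
  refine ⟨fun h ↦ ?_, mp⟩
  -- Any finite set of indices lies in finitely many degree layers, so by nonnegativity its partial
  -- sum is at most `a`.
  have hs : Summable g := by
    refine summable_of_sum_le hg (c := a) fun s ↦ ?_
    have hsub : s ⊆ (s.image Finsupp.degree).biUnion
        fun k ↦ (Finset.univ : Finset (Fin m)).finsuppAntidiag k := by
      intro n hn
      exact Finset.mem_biUnion.2
        ⟨n.degree, Finset.mem_image_of_mem _ hn, mem_finsuppAntidiag_univ_iff.2 rfl⟩
    refine (Finset.sum_le_sum_of_subset_of_nonneg hsub fun n _ _ ↦ hg n).trans ?_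
    rw [Finset.sum_biUnion]
    · exact sum_le_hasSum _ (fun k _ ↦ Finset.sum_nonneg fun n _ ↦ hg n) h
    · intro k _ l _ hkl
      refine Finset.disjoint_left.2 fun n hk hl ↦ hkl ?_
      rw [mem_finsuppAntidiag_univ_iff] at hk hl
      exact hk.symm.trans hl
  have := mp hs.hasSum
  rw [h.unique this]
  exact hs.hasSum

/-- By orthogonality the `k`-th term is the sum over the layer `|n| = k`. An arbitrary power series
is allowed, so that the lemma can also establish membership in `H²(β)` for a substituted series. -/
theorem hasSum_sphereNormSq_iff {m : ℕ} (hm : 1 ≤ m) {β : (Fin m →₀ ℕ) → Set.Ioi (0 : ℝ)}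
    {b : ℕ → ℝ} (h : ∀ n, (β n : ℝ) ^ 2 = b n.degree ^ 2 * monomialNormSq n)
    (f : MvPowerSeries (Fin m) ℂ) {a : ℝ} :
    HasSum (fun k ↦ b k ^ 2 * sphereNormSq (homogeneousPart k f)) a ↔
      HasSum (fun n ↦ ‖MvPowerSeries.coeff n f‖ ^ 2 * (β n : ℝ) ^ 2) a := by
  rw [← hasSum_degree_iff fun n ↦ by positivity]
  have (k : ℕ) : b k ^ 2 * sphereNormSq (homogeneousPart k f) =
      ∑ n ∈ (Finset.univ : Finset (Fin m)).finsuppAntidiag k,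
        ‖MvPowerSeries.coeff n f‖ ^ 2 * (β n : ℝ) ^ 2 := by
    rw [sphereNormSq_homogeneousPart hm, Finset.mul_sum]
    refine Finset.sum_congr rfl fun n hn ↦ ?_
    rw [h n, mem_finsuppAntidiag_univ_iff.1 hn]
    ring
  simp_rw [this]

/-- On `zⁿ` the series in (1) has one nonzero term, which gives the formula; the converse is
summation by degree. -/
theorem isScalarWeight_iff {m : ℕ} (hm : 1 ≤ m) (β : (Fin m →₀ ℕ) → Set.Ioi (0 : ℝ)) (b : ℕ → ℝ) :
    IsScalarWeight β b ↔
      (∀ k, 0 < b k) ∧ ∀ n, (β n : ℝ) ^ 2 = b n.degree ^ 2 * monomialNormSq n := by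
  refine ⟨fun h ↦ ⟨h.pos, fun n ↦ ?_⟩, fun h ↦ ⟨h.1, fun f ↦ ?_⟩⟩
  · have h1 := h.hasSum_norm_sq (H2.ofPolynomial β (MvPolynomial.monomial n 1))
    have hk (k : ℕ) : sphereNormSq (homogeneousPart k
        (H2.toSeries (H2.ofPolynomial β (MvPolynomial.monomial n 1)))) =
        if k = n.degree then monomialNormSq n else 0 := by
      rw [sphereNormSq_homogeneousPart hm]
      simp only [H2.toSeries_ofPolynomial, MvPolynomial.coeff_coe, MvPolynomial.coeff_monomial]
      split_ifs with hkn
      · rw [Finset.sum_eq_single_of_mem n (mem_finsuppAntidiag_univ_iff.2 hkn.symm)]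
        · simp
        · intro l _ hl
          simp [hl.symm]
      · refine Finset.sum_eq_zero fun l hl ↦ ?_
        rw [if_neg]
        · simp
        · rintro rfl
          exact hkn (mem_finsuppAntidiag_univ_iff.1 hl).symm
    simp_rw [hk] at h1
    have h2 := h1.unique (hasSum_single n.degree fun k hk ↦ by rw [if_neg hk, mul_zero])
    rw [H2.norm_sq_ofPolynomial_monomial, if_pos rfl] at h2
    simpa using h2
  · exact (hasSum_sphereNormSq_iff hm h.2 _).2 (H2.hasSum_norm_sq f)

theorem prod_factorial_add_single {m : ℕ} (n : Fin m →₀ ℕ) (i : Fin m) :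
    ∏ j, (((n + Finsupp.single i 1 : Fin m →₀ ℕ) j).factorial : ℝ) =
      ((n i : ℝ) + 1) * ∏ j, ((n j).factorial : ℝ) := by
  rw [← Finset.mul_prod_erase _ _ (Finset.mem_univ i),
    ← Finset.mul_prod_erase _ (fun j ↦ ((n j).factorial : ℝ)) (Finset.mem_univ i)]
  have : ∀ j ∈ Finset.univ.erase i,
      (((n + Finsupp.single i 1 : Fin m →₀ ℕ) j).factorial : ℝ) = ((n j).factorial : ℝ) := by
    intro j hj
    rw [Finsupp.add_apply, Finsupp.single_eq_of_ne (Finset.ne_of_mem_erase hj), add_zero]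
  rw [Finset.prod_congr rfl this]
  simp [Nat.factorial_succ, mul_assoc]

theorem monomialNormSq_add_single {m : ℕ} (hm : 1 ≤ m) (n : Fin m →₀ ℕ) (i : Fin m) :
    monomialNormSq (n + Finsupp.single i 1) =
      (((n i : ℝ) + 1) / ((n.degree : ℝ) + m)) * monomialNormSq n := by
  obtain ⟨p, rfl⟩ : ∃ p, m = p + 1 := ⟨m - 1, by omega⟩
  unfold monomialNormSq
  rw [prod_factorial_add_single, map_add, Finsupp.degree_single, Nat.add_sub_cancel, ← add_assoc,
    Nat.factorial_succ]
  have h1 : ((n.degree : ℝ) + ((p + 1 : ℕ) : ℝ)) ≠ 0 := by positivity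
  have h2 : ((p + n.degree).factorial : ℝ) ≠ 0 := by positivity
  push_cast at h1 ⊢
  have h3 : ((p : ℝ) + n.degree + 1) ≠ 0 := by positivity
  field_simp
  ring

theorem IsScalarWeight.coe_eq {m : ℕ} (hm : 1 ≤ m) {β : (Fin m →₀ ℕ) → Set.Ioi (0 : ℝ)}
    {b : ℕ → ℝ} (hb : IsScalarWeight β b) (n : Fin m →₀ ℕ) :
    (β n : ℝ) = b n.degree * √(monomialNormSq n) := by
  obtain ⟨hpos, h⟩ := (isScalarWeight_iff hm β b).1 hb
  have hβ : 0 < (β n : ℝ) := (β n).2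
  rw [← Real.sqrt_sq hβ.le, h n, Real.sqrt_mul (sq_nonneg _), Real.sqrt_sq (hpos _).le]

theorem IsScalarWeight.div_eq {m : ℕ} (hm : 1 ≤ m) {β : (Fin m →₀ ℕ) → Set.Ioi (0 : ℝ)}
    {b : ℕ → ℝ} (hb : IsScalarWeight β b) (n : Fin m →₀ ℕ) (i : Fin m) :
    (β (n + Finsupp.single i 1) : ℝ) / β n =
      b (n.degree + 1) / b n.degree * √(((n i : ℝ) + 1) / ((n.degree : ℝ) + (m : ℝ))) := by
  have h0 : √(monomialNormSq n) ≠ 0 := (Real.sqrt_pos.2 (monomialNormSq_pos n)).ne'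
  have h1 := (hb.pos n.degree).ne'
  rw [hb.coe_eq hm, hb.coe_eq hm, monomialNormSq_add_single hm, Real.sqrt_mul (by positivity),
    map_add, Finsupp.degree_single]
  field_simp

/-! ### The weighted shift model. -/

namespace H2

variable {m : ℕ} (β : (Fin m →₀ ℕ) → Set.Ioi (0 : ℝ))

/-- `toLp` as a unitary operator. -/
def toLpIsometry : H2 β ≃ₗᵢ[ℂ] lp (fun _ : Fin m →₀ ℕ => ℂ) 2 where
  toLinearEquiv := toLp β
  norm_map' f := by rw [@norm_eq_sqrt_re_inner ℂ, @norm_eq_sqrt_re_inner ℂ, inner_toLp]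

theorem toLpIsometry_monomial (n : Fin m →₀ ℕ) :
    toLpIsometry β (ofPolynomial β (MvPolynomial.monomial n 1)) =
      ((β n : ℝ) : ℂ) • (lp.single 2 n (1 : ℂ) : lp (fun _ : Fin m →₀ ℕ => ℂ) 2) := by
  apply lp.ext
  funext l
  rw [lp.coeFn_smul, Pi.smul_apply, lp.coeFn_single]
  change ((β l : ℝ) : ℂ) * MvPowerSeries.coeff l (toSeries (ofPolynomial β _)) = _
  rw [toSeries_ofPolynomial, MvPolynomial.coeff_coe, MvPolynomial.coeff_monomial]
  rcases eq_or_ne n l with rfl | h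
  · simp
  · simp [h]

end H2

/-- The unitary `V` sends `zⁿ` to `β_n e_n`. Conjugating `M` by it makes boundedness and commutation
automatic, and the weights are read off from `z_j zⁿ = z^{n+ε_j}`. -/
theorem exists_weightedShift {m : ℕ} {β : (Fin m →₀ ℕ) → Set.Ioi (0 : ℝ)}
    {M : Fin m → H2 β →L[ℂ] H2 β} (hM : IsMultiplicationTuple β M)
    {K : Type*} [NormedAddCommGroup K] [InnerProductSpace ℂ K]
    (e : HilbertBasis (Fin m →₀ ℕ) ℂ K) :
    ∃ T : Fin m → K →L[ℂ] K,
      IsWeightedShift e (fun i n ↦ (β (n + Finsupp.single i 1) : ℝ) / β n) T ∧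
      UnitarilyEquivalent M T := by
  let V : H2 β ≃ₗᵢ[ℂ] K := (H2.toLpIsometry β).trans e.repr.symm
  have hV (n : Fin m →₀ ℕ) : V (H2.ofPolynomial β (MvPolynomial.monomial n 1)) =
      ((β n : ℝ) : ℂ) • e n := by
    simp only [V, LinearIsometryEquiv.trans_apply, H2.toLpIsometry_monomial, map_smul]
    congr 1
    rw [LinearIsometryEquiv.symm_apply_eq, e.repr_self]
  have hβ (n : Fin m →₀ ℕ) : ((β n : ℝ) : ℂ) ≠ 0 := by exact_mod_cast (ne_of_gt (β n).2)
  let T : Fin m → K →L[ℂ] K := fun j ↦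
    (V.toContinuousLinearEquiv : H2 β →L[ℂ] K) ∘L M j ∘L
      (V.symm.toContinuousLinearEquiv : K →L[ℂ] H2 β)
  have hT (j : Fin m) (x : K) : T j x = V (M j (V.symm x)) := rfl
  refine ⟨T, ⟨fun j n ↦ div_pos (β _).2 (β _).2, fun i j ↦ ?_, fun j n ↦ ?_⟩, V, fun j h ↦ ?_⟩
  · refine ContinuousLinearMap.ext fun x ↦ ?_
    change T i (T j x) = T j (T i x)
    simp only [hT, LinearIsometryEquiv.symm_apply_apply]
    exact congrArg V (DFunLike.congr_fun (hM.commute i j).eq _)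
  · have he : e n = ((β n : ℝ) : ℂ)⁻¹ • V (H2.ofPolynomial β (MvPolynomial.monomial n 1)) := by
      rw [hV, inv_smul_smul₀ (hβ n)]
    rw [he, map_smul, hT, LinearIsometryEquiv.symm_apply_apply, H2.multiplication_ofPolynomial hM,
      MvPolynomial.X, MvPolynomial.monomial_mul, one_mul, add_comm, hV, smul_smul]
    push_cast
    rw [mul_comm, div_eq_mul_inv]
  · rw [hT, LinearIsometryEquiv.symm_apply_apply]

/-! ### Linear substitutions in power series; (1) implies spherical. -/

theorem coeff_homogeneousPart {m : ℕ} (k : ℕ) (f : MvPowerSeries (Fin m) ℂ) (n : Fin m →₀ ℕ) :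
    MvPolynomial.coeff n (homogeneousPart k f) =
      if n.degree = k then MvPowerSeries.coeff n f else 0 := by
  simp only [homogeneousPart, MvPolynomial.coeff_sum, MvPolynomial.coeff_monomial,
    Finset.sum_ite_eq', mem_finsuppAntidiag_univ_iff]

theorem isHomogeneous_homogeneousPart {m : ℕ} (k : ℕ) (f : MvPowerSeries (Fin m) ℂ) :
    (homogeneousPart k f).IsHomogeneous k := by
  intro n hn
  rw [coeff_homogeneousPart] at hn
  rw [Pi.one_def, ← Finsupp.degree_eq_weight_one]
  by_contra h
  exact hn (if_neg h)

theorem coeff_eq_zero_of_isHomogeneous {m : ℕ} {p : MvPolynomial (Fin m) ℂ} {k : ℕ}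
    (hp : p.IsHomogeneous k) {n : Fin m →₀ ℕ} (hn : n.degree ≠ k) : MvPolynomial.coeff n p = 0 := by
  by_contra h
  refine hn ?_
  rw [Finsupp.degree_eq_weight_one]
  exact hp h

/-- The substitution `z_j ↦ ∑_k u_jk z_k` in formal power series. -/
def linearSubstSeries {m : ℕ} (U : Matrix (Fin m) (Fin m) ℂ) :
    MvPowerSeries (Fin m) ℂ →ₗ[ℂ] MvPowerSeries (Fin m) ℂ where
  toFun f := fun n ↦ MvPolynomial.coeff n (linearSubst U (homogeneousPart n.degree f))
  map_add' f g := by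
    have (k : ℕ) : homogeneousPart k (f + g) = homogeneousPart k f + homogeneousPart k g := by
      simp [homogeneousPart, Finset.sum_add_distrib]
    funext n
    rw [this, map_add, MvPolynomial.coeff_add]
    rfl
  map_smul' c f := by
    have (k : ℕ) : homogeneousPart k (c • f) = c • homogeneousPart k f := by
      simp [homogeneousPart, Finset.smul_sum, MvPolynomial.smul_monomial]
    funext n
    rw [this, map_smul, MvPolynomial.coeff_smul]
    rfl

theorem coeff_linearSubstSeries {m : ℕ} (U : Matrix (Fin m) (Fin m) ℂ)
    (f : MvPowerSeries (Fin m) ℂ) (n : Fin m →₀ ℕ) :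
    MvPowerSeries.coeff n (linearSubstSeries U f) =
      MvPolynomial.coeff n (linearSubst U (homogeneousPart n.degree f)) := rfl

theorem homogeneousPart_linearSubstSeries {m : ℕ} (U : Matrix (Fin m) (Fin m) ℂ) (k : ℕ)
    (f : MvPowerSeries (Fin m) ℂ) :
    homogeneousPart k (linearSubstSeries U f) = linearSubst U (homogeneousPart k f) := by
  ext n
  rw [coeff_homogeneousPart]
  split_ifs with h
  · rw [coeff_linearSubstSeries, h]
  · exact (coeff_eq_zero_of_isHomogeneous
      (isHomogeneous_linearSubst U (isHomogeneous_homogeneousPart k f)) h).symm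

theorem linearSubstSeries_linearSubstSeries {m : ℕ} (U V : Matrix (Fin m) (Fin m) ℂ)
    (f : MvPowerSeries (Fin m) ℂ) :
    linearSubstSeries U (linearSubstSeries V f) = linearSubstSeries (V * U) f := by
  ext n
  rw [coeff_linearSubstSeries, homogeneousPart_linearSubstSeries, linearSubst_linearSubst,
    coeff_linearSubstSeries]

theorem linearSubstSeries_one {m : ℕ} (f : MvPowerSeries (Fin m) ℂ) :
    linearSubstSeries 1 f = f := by
  ext n
  rw [coeff_linearSubstSeries, linearSubst_one, coeff_homogeneousPart, if_pos rfl]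

/-- This reduces products with `z_j` to polynomials. The truncated `n.degree - 1` is harmless at `n
= 0`, where both sides vanish. -/
theorem coeff_X_mul_series {m : ℕ} (j : Fin m) (f : MvPowerSeries (Fin m) ℂ) (n : Fin m →₀ ℕ) :
    MvPowerSeries.coeff n (MvPowerSeries.X j * f) =
      MvPolynomial.coeff n (MvPolynomial.X j * homogeneousPart (n.degree - 1) f) := by
  rw [MvPowerSeries.X_def, MvPowerSeries.coeff_monomial_mul, MvPolynomial.coeff_X_mul']
  by_cases h : Finsupp.single j 1 ≤ n
  · have h' : j ∈ n.support := by
      rw [Finsupp.mem_support_iff]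
      have := h j
      simp only [Finsupp.single_eq_same] at this
      omega
    have hd : (n - Finsupp.single j 1).degree = n.degree - 1 := by
      have := congrArg Finsupp.degree (tsub_add_cancel_of_le h)
      rw [map_add, Finsupp.degree_single] at this
      omega
    rw [if_pos h, if_pos h', one_mul, coeff_homogeneousPart, if_pos hd]
  · have h' : j ∉ n.support := by
      rw [Finsupp.mem_support_iff, not_not]
      by_contra h0
      exact h (Finsupp.single_le_iff.2 (Nat.one_le_iff_ne_zero.2 h0))
    rw [if_neg h, if_neg h']

theorem homogeneousPart_succ_X_mul {m : ℕ} (j : Fin m) (f : MvPowerSeries (Fin m) ℂ) (k : ℕ) :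
    homogeneousPart (k + 1) (MvPowerSeries.X j * f) =
      MvPolynomial.X j * homogeneousPart k f := by
  ext n
  rw [coeff_homogeneousPart]
  split_ifs with h
  · rw [coeff_X_mul_series, h, Nat.add_sub_cancel]
  · refine (coeff_eq_zero_of_isHomogeneous ((MvPolynomial.isHomogeneous_X ℂ j).mul
      (isHomogeneous_homogeneousPart k f)) ?_).symm
    omega

/-- This is the intertwining relation. In positive degree it is multiplicativity of the polynomial
substitution; in degree zero neither side has a constant term. -/
theorem linearSubstSeries_X_mul {m : ℕ} (U : Matrix (Fin m) (Fin m) ℂ) (j : Fin m)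
    (f : MvPowerSeries (Fin m) ℂ) :
    linearSubstSeries U (MvPowerSeries.X j * f) =
      ∑ k, U j k • (MvPowerSeries.X k * linearSubstSeries U f) := by
  ext n
  rw [coeff_linearSubstSeries, map_sum]
  simp only [MvPowerSeries.coeff_smul]
  rcases Nat.eq_zero_or_pos n.degree with h | h
  · have hn : n = 0 := (Finsupp.degree_eq_zero_iff _).1 h
    subst hn
    have h0 : homogeneousPart 0 (MvPowerSeries.X j * f) = 0 := by
      ext n
      rw [coeff_homogeneousPart]
      split_ifs with h
      · rw [(Finsupp.degree_eq_zero_iff _).1 h, MvPowerSeries.coeff_zero_X_mul]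
        simp
      · simp
    rw [h, h0]
    simp [MvPowerSeries.coeff_zero_X_mul]
  · obtain ⟨k, hk⟩ : ∃ k, n.degree = k + 1 := ⟨n.degree - 1, by omega⟩
    simp only [coeff_X_mul_series, hk, Nat.add_sub_cancel, homogeneousPart_succ_X_mul, map_mul,
      linearSubst_X, homogeneousPart_linearSubstSeries, Finset.sum_mul, MvPolynomial.coeff_sum,
      smul_mul_assoc, MvPolynomial.coeff_smul, smul_eq_mul]

/-- Each homogeneous part keeps its sphere norm. The conclusion yields at once that the substituted
series is in `H²(β)` and that its norm is unchanged. -/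
theorem hasSum_linearSubstSeries {m : ℕ} (hm : 1 ≤ m) {β : (Fin m →₀ ℕ) → Set.Ioi (0 : ℝ)}
    {b : ℕ → ℝ} (h : ∀ n, (β n : ℝ) ^ 2 = b n.degree ^ 2 * monomialNormSq n)
    {U : Matrix (Fin m) (Fin m) ℂ} (hU : U ∈ Matrix.unitaryGroup (Fin m) ℂ) (f : H2 β) :
    HasSum (fun n ↦ ‖MvPowerSeries.coeff n (linearSubstSeries U (H2.toSeries f))‖ ^ 2 *
      (β n : ℝ) ^ 2) (‖f‖ ^ 2) := by
  rw [← hasSum_sphereNormSq_iff hm h]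
  simp_rw [homogeneousPart_linearSubstSeries,
    sphereNormSq_linearSubst hm hU (isHomogeneous_homogeneousPart _ _)]
  rw [hasSum_sphereNormSq_iff hm h]
  exact H2.hasSum_norm_sq f

/-- The substitution `z_j ↦ ∑_k u_jk z_k` in `H²(β)`, when it preserves `H²(β)`. -/
def H2.linearSubst {m : ℕ} {β : (Fin m →₀ ℕ) → Set.Ioi (0 : ℝ)} (U : Matrix (Fin m) (Fin m) ℂ)
    (hU : ∀ f : H2 β, MemH2 β (linearSubstSeries U (H2.toSeries f))) : H2 β →ₗ[ℂ] H2 β :=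
  ((linearSubstSeries U).comp H2.toSeries).codRestrict (H2Submodule β) hU

theorem H2.toSeries_linearSubst {m : ℕ} {β : (Fin m →₀ ℕ) → Set.Ioi (0 : ℝ)}
    (U : Matrix (Fin m) (Fin m) ℂ)
    (hU : ∀ f : H2 β, MemH2 β (linearSubstSeries U (H2.toSeries f))) (f : H2 β) :
    H2.toSeries (H2.linearSubst U hU f) = linearSubstSeries U (H2.toSeries f) := rfl

theorem H2.linearSubst_comp {m : ℕ} {β : (Fin m →₀ ℕ) → Set.Ioi (0 : ℝ)}
    (U V : Matrix (Fin m) (Fin m) ℂ)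
    (hU : ∀ f : H2 β, MemH2 β (linearSubstSeries U (H2.toSeries f)))
    (hV : ∀ f : H2 β, MemH2 β (linearSubstSeries V (H2.toSeries f))) (h : V * U = 1) :
    (H2.linearSubst U hU).comp (H2.linearSubst V hV) = LinearMap.id := by
  refine LinearMap.ext fun f ↦ H2.toSeries_injective ?_
  rw [LinearMap.comp_apply, H2.toSeries_linearSubst, H2.toSeries_linearSubst,
    linearSubstSeries_linearSubstSeries, h, linearSubstSeries_one, LinearMap.id_apply]

theorem isSpherical_of_isScalarWeight {m : ℕ} (hm : 1 ≤ m) {β : (Fin m →₀ ℕ) → Set.Ioi (0 : ℝ)}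
    {M : Fin m → H2 β →L[ℂ] H2 β} (hM : IsMultiplicationTuple β M) {b : ℕ → ℝ}
    (hb : IsScalarWeight β b) : IsSpherical M := by
  obtain ⟨-, h⟩ := (isScalarWeight_iff hm β b).1 hb
  refine ⟨IsMultiplicationTuple.infinite_dimensional hm β, hM.commute, fun U hU ↦ ?_⟩
  have hmem {W : Matrix (Fin m) (Fin m) ℂ} (hW : W ∈ Matrix.unitaryGroup (Fin m) ℂ) (f : H2 β) :
      MemH2 β (linearSubstSeries W (H2.toSeries f)) :=
    (hasSum_linearSubstSeries hm h hW f).summable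
  have hU' : star U ∈ Matrix.unitaryGroup (Fin m) ℂ := Unitary.star_mem hU
  -- The inverse of the substitution by `U` is the substitution by `star U`.
  let Γ : H2 β ≃ₗᵢ[ℂ] H2 β :=
    { toLinearEquiv := LinearEquiv.ofLinearMap (H2.linearSubst U (hmem hU))
        (H2.linearSubst (star U) (hmem hU'))
        (H2.linearSubst_comp _ _ _ _ (Matrix.mem_unitaryGroup_iff'.1 hU))
        (H2.linearSubst_comp _ _ _ _ (Matrix.mem_unitaryGroup_iff.1 hU))
      norm_map' := fun f ↦ by
        have h1 := (H2.hasSum_norm_sq (H2.linearSubst U (hmem hU) f)).unique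
          (hasSum_linearSubstSeries hm h hU f)
        exact (sq_eq_sq₀ (norm_nonneg _) (norm_nonneg _)).1 h1 }
  have hΓ (f) : H2.toSeries (Γ f) = linearSubstSeries U (H2.toSeries f) := rfl
  refine ⟨Γ, fun j f ↦ H2.toSeries_injective ?_⟩
  rw [hΓ, hM, linearSubstSeries_X_mul, _root_.sum_apply, map_sum]
  refine Finset.sum_congr rfl fun k _ ↦ ?_
  rw [_root_.smul_apply, map_smul, hM, hΓ]

/-! ### Intertwiners are substitutions up to a unimodular constant. -/

namespace H2

variable {m : ℕ} {β : (Fin m →₀ ℕ) → Set.Ioi (0 : ℝ)}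

theorem inner_ofPolynomial_monomial (n : Fin m →₀ ℕ) (f : H2 β) :
    inner ℂ (ofPolynomial β (MvPolynomial.monomial n 1)) f =
      (((β n : ℝ) ^ 2 : ℝ) : ℂ) * coeff n f := by
  change ∑' l, (((β l : ℝ) ^ 2 : ℝ) : ℂ) * (starRingEnd ℂ (coeff l _) * coeff l f) = _
  rw [tsum_eq_single n]
  · simp [coeff_ofPolynomial]
  · intro l hl
    rw [coeff_ofPolynomial, MvPolynomial.coeff_monomial, if_neg hl.symm]
    simp

theorem inner_one_multiplication {M : Fin m → H2 β →L[ℂ] H2 β} (hM : IsMultiplicationTuple β M)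
    (j : Fin m) (f : H2 β) : inner ℂ (ofPolynomial β 1) (M j f) = 0 := by
  have h1 : (1 : MvPolynomial (Fin m) ℂ) = MvPolynomial.monomial 0 1 := rfl
  rw [h1, inner_ofPolynomial_monomial, coeff, hM,
    MvPowerSeries.coeff_zero_X_mul, mul_zero]

/-- A unitary operator intertwining `M_z` with a unitary recombination of it fixes the constants
up to a unimodular factor. -/
theorem exists_intertwiner_one {M : Fin m → H2 β →L[ℂ] H2 β} (hM : IsMultiplicationTuple β M)
    {U : Matrix (Fin m) (Fin m) ℂ} (hU : U ∈ Matrix.unitaryGroup (Fin m) ℂ)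
    (Γ : H2 β ≃ₗᵢ[ℂ] H2 β) (hΓ : ∀ j h, Γ (M j h) = (∑ k, U j k • M k) (Γ h)) :
    ∃ c : ℂ, ‖c‖ = 1 ∧ Γ (ofPolynomial β 1) = c • ofPolynomial β 1 := by
  -- Inverting the relation by `U* U = 1` puts the range of each `M j` into the image under `Γ` of
  -- the sum of the ranges, which is orthogonal to `Γ 1`.
  have hrange (j : Fin m) (h : H2 β) : M j (Γ h) = Γ (∑ k, star (U k j) • M k h) := by
    have hUU : ∀ l, ∑ k, star (U k j) * U k l = if j = l then 1 else 0 := fun l ↦ by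
      have := congrFun (congrFun (Matrix.mem_unitaryGroup_iff'.1 hU) j) l
      simpa [Matrix.mul_apply, Matrix.one_apply, Matrix.star_apply] using this
    simp only [map_sum, map_smul, hΓ, _root_.sum_apply, _root_.smul_apply, Finset.smul_sum,
      smul_smul]
    rw [Finset.sum_comm]
    simp only [← Finset.sum_smul, hUU, ite_smul, one_smul, zero_smul, Finset.sum_ite_eq,
      Finset.mem_univ, if_true]
  have horth (j : Fin m) (g : H2 β) : inner ℂ (M j g) (Γ (ofPolynomial β 1)) = 0 := by
    rw [← Γ.apply_symm_apply g, hrange, Γ.inner_map_map, ← inner_conj_symm, inner_sum]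
    simp [inner_smul_right, inner_one_multiplication hM]
  -- Every nonconstant monomial lies in the range of some `M j`, so `Γ 1` is orthogonal to it.
  have hcoeff (n : Fin m →₀ ℕ) (hn : n ≠ 0) : coeff n (Γ (ofPolynomial β 1)) = 0 := by
    obtain ⟨j, hj⟩ := Finsupp.ne_iff.1 hn
    have hle : Finsupp.single j 1 ≤ n :=
      Finsupp.single_le_iff.2 (Nat.one_le_iff_ne_zero.2 hj)
    have h := horth j (ofPolynomial β (MvPolynomial.monomial (n - Finsupp.single j 1) 1))
    rw [multiplication_ofPolynomial hM, MvPolynomial.X, MvPolynomial.monomial_mul, one_mul,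
      add_tsub_cancel_of_le hle, inner_ofPolynomial_monomial] at h
    have hβ : (((β n : ℝ) ^ 2 : ℝ) : ℂ) ≠ 0 := by
      rw [Ne, Complex.ofReal_eq_zero]
      exact pow_ne_zero 2 (ne_of_gt (β n).2)
    exact (mul_eq_zero.1 h).resolve_left hβ
  have hΓ1 : Γ (ofPolynomial β 1) = coeff 0 (Γ (ofPolynomial β 1)) • ofPolynomial β 1 := by
    refine ext_coeff fun n ↦ ?_
    rw [coeff_smul, coeff_ofPolynomial, MvPolynomial.coeff_one]
    split_ifs with h
    · rw [← h, mul_one]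
    · rw [hcoeff n (Ne.symm h), mul_zero]
  refine ⟨_, ?_, hΓ1⟩
  have h1 := congrArg norm hΓ1
  rw [Γ.norm_map, norm_smul] at h1
  have h2 : ‖ofPolynomial β (1 : MvPolynomial (Fin m) ℂ)‖ ≠ 0 := by
    rw [norm_ne_zero_iff]
    intro h
    have := congrArg (coeff 0) h
    rw [coeff_ofPolynomial, MvPolynomial.coeff_one, if_pos rfl] at this
    exact one_ne_zero (this.trans (map_zero (MvPowerSeries.coeff 0)))
  exact mul_right_cancel₀ h2 (by rw [← h1, one_mul])

end H2

/-- Since `Γ 1 = c`, moving the variables past `Γ` one at a time gives `Γ p = c p(Uz)`, with `|c| =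
1`. -/
theorem IsSpherical.norm_linearSubst {m : ℕ} {β : (Fin m →₀ ℕ) → Set.Ioi (0 : ℝ)}
    {M : Fin m → H2 β →L[ℂ] H2 β} (hM : IsMultiplicationTuple β M) (hS : IsSpherical M)
    {U : Matrix (Fin m) (Fin m) ℂ} (hU : U ∈ Matrix.unitaryGroup (Fin m) ℂ)
    (p : MvPolynomial (Fin m) ℂ) :
    ‖H2.ofPolynomial β (linearSubst U p)‖ = ‖H2.ofPolynomial β p‖ := by
  obtain ⟨Γ, hΓ⟩ := hS.exists_unitary U hU
  obtain ⟨c, hc, hc1⟩ := H2.exists_intertwiner_one hM hU Γ hΓ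
  have key : Γ (H2.ofPolynomial β p) = c • H2.ofPolynomial β (linearSubst U p) := by
    induction p using MvPolynomial.induction_on with
    | C a =>
      have : linearSubst U (MvPolynomial.C a) = MvPolynomial.C a :=
        (linearSubst U).commutes a
      rw [this, ← mul_one (MvPolynomial.C a), ← MvPolynomial.smul_eq_C_mul, map_smul, map_smul,
        hc1, smul_comm]
    | add p q hp hq => rw [map_add, map_add, hp, hq, map_add, map_add, smul_add]
    | mul_X p j hp =>
      rw [mul_comm, ← H2.multiplication_ofPolynomial hM, hΓ, hp, map_smul, map_mul, linearSubst_X,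
        _root_.sum_apply, Finset.sum_mul, map_sum]
      simp only [_root_.smul_apply, H2.multiplication_ofPolynomial hM, smul_mul_assoc, map_smul]
  rw [← Γ.norm_map (H2.ofPolynomial β p), key, norm_smul, hc, one_mul]

/-! ### Plane rotations and the dependence of `β` on `n`; spherical implies (1). -/

/-- The rotation in the coordinates `i`, `j` with cosine `c` and sine `s`. -/
def planeRotation {m : ℕ} (i j : Fin m) (c s : ℝ) : Matrix (Fin m) (Fin m) ℂ :=
  1 + ((c : ℂ) - 1) • (Matrix.single i i 1 + Matrix.single j j 1) +
    (s : ℂ) • (Matrix.single i j 1 - Matrix.single j i 1)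

theorem planeRotation_mem_unitaryGroup {m : ℕ} {i j : Fin m} (hij : i ≠ j) {c s : ℝ}
    (h : c ^ 2 + s ^ 2 = 1) : planeRotation i j c s ∈ Matrix.unitaryGroup (Fin m) ℂ := by
  rw [Matrix.mem_unitaryGroup_iff, planeRotation]
  set A : Matrix (Fin m) (Fin m) ℂ := Matrix.single i i 1 + Matrix.single j j 1 with hA
  set B : Matrix (Fin m) (Fin m) ℂ := Matrix.single i j 1 - Matrix.single j i 1 with hB
  -- `A` is the projection onto the coordinate plane and `B` a quarter turn in it. With these
  -- relations unitarity reduces to the coefficient of `A`, which is `c² + s² - 1`.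
  have hAA : A * A = A := by simp [hA, mul_add, add_mul, hij, hij.symm]
  have hAB : A * B = B := by simp [hA, hB, mul_sub, add_mul, hij, hij.symm]
  have hBA : B * A = B := by
    simp [hA, hB, mul_add, sub_mul, hij, hij.symm]
    abel
  have hBB : B * B = -A := by
    simp [hA, hB, mul_sub, sub_mul, hij, hij.symm]
    abel
  have hAs : star A = A := by simp [hA, Matrix.star_eq_conjTranspose]
  have hBs : star B = -B := by simp [hB, Matrix.star_eq_conjTranspose]
  have hstar : star (1 + ((c : ℂ) - 1) • A + (s : ℂ) • B) =
      1 + ((c : ℂ) - 1) • A - (s : ℂ) • B := by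
    simp [star_add, star_smul, hAs, hBs, sub_eq_add_neg]
  have hc : ((c : ℂ) ^ 2 + (s : ℂ) ^ 2) = 1 := by exact_mod_cast h
  rw [hstar]
  simp only [mul_sub, mul_add, add_mul, mul_one, one_mul, smul_mul_assoc, mul_smul_comm, hAA, hAB,
    hBA, hBB, smul_neg]
  have : (2 * ((c : ℂ) - 1) + ((c : ℂ) - 1) * ((c : ℂ) - 1) + (s : ℂ) * s) • A = 0 := by
    have : (2 * ((c : ℂ) - 1) + ((c : ℂ) - 1) * ((c : ℂ) - 1) + (s : ℂ) * s) = 0 := by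
      linear_combination hc
    rw [this, zero_smul]
  rw [← sub_eq_zero]
  rw [← this]
  module

theorem linearSubst_planeRotation_left {m : ℕ} {i j : Fin m} (hij : i ≠ j) (c s : ℝ) :
    linearSubst (planeRotation i j c s) (MvPolynomial.X i) =
      (c : ℂ) • MvPolynomial.X i + (s : ℂ) • MvPolynomial.X j := by
  simp [linearSubst_X, planeRotation, Matrix.one_apply, Matrix.single_apply, add_smul,
    Finset.sum_add_distrib, hij.symm, sub_smul]

theorem linearSubst_planeRotation_of_ne {m : ℕ} {i j k : Fin m} (hi : k ≠ i) (hj : k ≠ j)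
    (c s : ℝ) : linearSubst (planeRotation i j c s) (MvPolynomial.X k) = MvPolynomial.X k := by
  simp [linearSubst_X, planeRotation, Matrix.one_apply, hi.symm, hj.symm]

/-- The variables in `p` are fixed, and `(c z_i + s z_j)^d` is expanded by the binomial theorem. -/
theorem linearSubst_planeRotation_monomial {m : ℕ} {i j : Fin m} (hij : i ≠ j) (c s : ℝ)
    {p : Fin m →₀ ℕ} (hpi : p i = 0) (hpj : p j = 0) (d : ℕ) :
    linearSubst (planeRotation i j c s) (MvPolynomial.monomial (p + Finsupp.single i d) 1) =
      ∑ t ∈ Finset.range (d + 1), MvPolynomial.monomial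
        (p + Finsupp.single i t + Finsupp.single j (d - t)) ((c : ℂ) ^ t * (s : ℂ) ^ (d - t) *
          (d.choose t : ℂ)) := by
  have hp : linearSubst (planeRotation i j c s) (MvPolynomial.monomial p 1) =
      MvPolynomial.monomial p 1 := by
    rw [MvPolynomial.monomial_eq, MvPolynomial.C_1, one_mul, Finsupp.prod, map_prod]
    refine Finset.prod_congr rfl fun k hk ↦ ?_
    rw [Finsupp.mem_support_iff] at hk
    rw [map_pow, linearSubst_planeRotation_of_ne]
    · rintro rfl
      exact hk hpi
    · rintro rfl
      exact hk hpj
  have hmon (a : ℕ) (k : Fin m) (z : ℂ) : (z • MvPolynomial.X k : MvPolynomial (Fin m) ℂ) ^ a =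
      MvPolynomial.monomial (Finsupp.single k a) (z ^ a) := by
    rw [smul_pow, MvPolynomial.X_pow_eq_monomial, MvPolynomial.smul_monomial, smul_eq_mul, mul_one]
  have hsplit : (MvPolynomial.monomial (p + Finsupp.single i d) 1 : MvPolynomial (Fin m) ℂ) =
      MvPolynomial.monomial p 1 * MvPolynomial.X i ^ d := by
    rw [MvPolynomial.X_pow_eq_monomial, MvPolynomial.monomial_mul, one_mul]
  rw [hsplit, map_mul, map_pow, hp, linearSubst_planeRotation_left hij, add_pow, Finset.mul_sum]
  refine Finset.sum_congr rfl fun t _ ↦ ?_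
  rw [hmon, hmon, MvPolynomial.monomial_mul, ← map_natCast MvPolynomial.C,
    mul_comm _ (MvPolynomial.C _), MvPolynomial.C_mul_monomial, MvPolynomial.monomial_mul, one_mul, mul_comm (_ : ℂ), add_assoc]

/-- The monomials in the rotated `z^p z_i^d` are orthogonal, so isometry gives an identity in `c²`
and `s²` valid whenever `c² + s² = 1`. In terms of `y = c²/s²` it is a polynomial identity with
right side a multiple of `(1 + y)^d`; comparing coefficients of `y^t` and cancelling one binomial
coefficient gives the claim. -/
theorem IsSpherical.choose_mul_sq {m : ℕ} {β : (Fin m →₀ ℕ) → Set.Ioi (0 : ℝ)}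
    {M : Fin m → H2 β →L[ℂ] H2 β} (hM : IsMultiplicationTuple β M) (hS : IsSpherical M)
    {i j : Fin m} (hij : i ≠ j) {p : Fin m →₀ ℕ} (hpi : p i = 0) (hpj : p j = 0) {d t : ℕ}
    (ht : t ≤ d) :
    (d.choose t : ℝ) * (β (p + Finsupp.single i t + Finsupp.single j (d - t)) : ℝ) ^ 2 =
      (β (p + Finsupp.single i d) : ℝ) ^ 2 := by
  let e (t : ℕ) : Fin m →₀ ℕ := p + Finsupp.single i t + Finsupp.single j (d - t)
  have he : Function.Injective e := fun a b hab ↦ by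
    have := DFunLike.congr_fun hab i
    simpa [e, hij] using this
  have hnorm (c s : ℝ) (hcs : c ^ 2 + s ^ 2 = 1) :
      ∑ t ∈ Finset.range (d + 1), ((c ^ 2) ^ t * (s ^ 2) ^ (d - t) * (d.choose t : ℝ) ^ 2) *
        (β (e t) : ℝ) ^ 2 = (β (p + Finsupp.single i d) : ℝ) ^ 2 := by
    have h := hS.norm_linearSubst hM (planeRotation_mem_unitaryGroup hij hcs)
      (MvPolynomial.monomial (p + Finsupp.single i d) 1)
    rw [← sq_eq_sq₀ (norm_nonneg _) (norm_nonneg _), H2.norm_sq_ofPolynomial_monomial, norm_one,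
      one_pow, one_mul, linearSubst_planeRotation_monomial hij c s hpi hpj,
      H2.norm_sq_ofPolynomial _ ((Finset.range (d + 1)).image e),
      Finset.sum_image he.injOn] at h
    · rw [← h]
      refine Finset.sum_congr rfl fun t ht ↦ ?_
      rw [MvPolynomial.coeff_sum, Finset.sum_eq_single_of_mem t ht]
      · rw [MvPolynomial.coeff_monomial, if_pos rfl]
        simp only [norm_mul, norm_pow, Complex.norm_real, Complex.norm_natCast, mul_pow,
          Real.norm_eq_abs]
        rw [pow_right_comm |c|, pow_right_comm |s|, sq_abs, sq_abs]
      · intro a _ ha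
        rw [MvPolynomial.coeff_monomial, if_neg fun h ↦ ha (he h)]
    · refine (MvPolynomial.support_sum).trans ?_
      intro n hn
      obtain ⟨t, ht, hnt⟩ := Finset.mem_biUnion.1 hn
      have := MvPolynomial.support_monomial_subset hnt
      exact Finset.mem_image.2 ⟨t, ht, (Finset.mem_singleton.1 this).symm⟩
  have hpoly : ∑ t ∈ Finset.range (d + 1),
        Polynomial.C ((d.choose t : ℝ) ^ 2 * (β (e t) : ℝ) ^ 2) * Polynomial.X ^ t =
      Polynomial.C ((β (p + Finsupp.single i d) : ℝ) ^ 2) * (Polynomial.X + 1) ^ d := by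
    refine Polynomial.eq_of_infinite_eval_eq _ _ ((Set.Ici_infinite (0 : ℝ)).mono fun y hy ↦ ?_)
    have hy0 : (0 : ℝ) ≤ y := hy
    have hy1 : (1 + y) ≠ 0 := by positivity
    -- These values realize `c²/s² = y` for any `y ≥ 0`; the denominators are then cleared by `(1 +
    -- y)^d`.
    have h := hnorm (√(y / (1 + y))) (√(1 / (1 + y))) (by
      rw [Real.sq_sqrt (by positivity), Real.sq_sqrt (by positivity)]
      field_simp
      ring)
    rw [Real.sq_sqrt (by positivity), Real.sq_sqrt (by positivity)] at h
    simp only [Set.mem_ofPred_eq, Polynomial.eval_finsetSum, Polynomial.eval_mul,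
      Polynomial.eval_C, Polynomial.eval_pow, Polynomial.eval_X, Polynomial.eval_add,
      Polynomial.eval_one]
    rw [← h, Finset.sum_mul]
    refine Finset.sum_congr rfl fun t ht ↦ ?_
    have htd : t + (d - t) = d := by
      have := Finset.mem_range.1 ht
      omega
    rw [div_pow, div_pow, one_pow, add_comm y 1]
    conv_rhs => rw [← htd, pow_add]
    rw [htd]
    field_simp
  have h := congrArg (fun P : Polynomial ℝ ↦ P.coeff t) hpoly
  simp only [Polynomial.finsetSum_coeff, Polynomial.coeff_C_mul, Polynomial.coeff_X_pow,
    Polynomial.coeff_X_add_one_pow, mul_ite, mul_one, mul_zero, Finset.sum_ite_eq,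
    Finset.mem_range, Nat.lt_succ_of_le ht, if_true] at h
  have h0 : (d.choose t : ℝ) ≠ 0 := by exact_mod_cast (Nat.choose_pos ht).ne'
  refine mul_left_cancel₀ h0 ?_
  linear_combination h

/-- Both `q + ε_i` and `q + ε_j` occur in the expansion of one rotated monomial, with `d = q_i + q_j
+ 1` and neighbouring values of `t`. The ratio of the two binomial coefficients gives the factors.
-/
theorem IsSpherical.sq_add_single {m : ℕ} {β : (Fin m →₀ ℕ) → Set.Ioi (0 : ℝ)}
    {M : Fin m → H2 β →L[ℂ] H2 β} (hM : IsMultiplicationTuple β M) (hS : IsSpherical M)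
    (q : Fin m →₀ ℕ) (i j : Fin m) :
    (β (q + Finsupp.single i 1) : ℝ) ^ 2 * ((q j : ℝ) + 1) =
      (β (q + Finsupp.single j 1) : ℝ) ^ 2 * ((q i : ℝ) + 1) := by
  rcases eq_or_ne i j with rfl | hij
  · rfl
  set p : Fin m →₀ ℕ := (q.erase i).erase j with hp
  have hpi : p i = 0 := by simp [hp, hij]
  have hpj : p j = 0 := by simp [hp]
  have hq (a : ℕ) (b : ℕ) : (p + Finsupp.single i (q i + a) + Finsupp.single j (q j + b)) =
      q + Finsupp.single i a + Finsupp.single j b := by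
    ext k
    rcases eq_or_ne k i with rfl | hki
    · simp [hpi, hij]
    · rcases eq_or_ne k j with rfl | hkj
      · simp [hpj, hki]
      · simp [hp, hki, hkj]
  have h1 := hS.choose_mul_sq hM hij hpi hpj (d := q i + q j + 1) (t := q i + 1) (by omega)
  have h2 := hS.choose_mul_sq hM hij hpi hpj (d := q i + q j + 1) (t := q i) (by omega)
  have e1 : q i + q j + 1 - (q i + 1) = q j := by omega
  have e2 : q i + q j + 1 - q i = q j + 1 := by omega
  have hq1 := hq 1 0
  have hq2 := hq 0 1
  simp only [Finsupp.single_zero, add_zero] at hq1 hq2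
  rw [e1, hq1, ← h2, e2, hq2] at h1
  have hc := Nat.choose_succ_right_eq (q i + q j + 1) (q i)
  rw [e2] at hc
  have hc' : ((q i + q j + 1).choose (q i + 1) : ℝ) * (q i + 1) =
      (q i + q j + 1).choose (q i) * (q j + 1) := by exact_mod_cast hc
  have h0 : ((q i + q j + 1).choose (q i) : ℝ) ≠ 0 := by
    exact_mod_cast (Nat.choose_pos (by omega)).ne'
  refine mul_left_cancel₀ h0 ?_
  linear_combination (q i + 1 : ℝ) * h1 - (β (q + Finsupp.single i 1) : ℝ) ^ 2 * hc'

/-- By `sq_add_single`, `β_n² / n!` does not change when one unit of the exponent moves from one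
coordinate to another, so all of it can be moved to coordinate `i`. -/
theorem IsSpherical.sq_div_prod_factorial {m : ℕ} {β : (Fin m →₀ ℕ) → Set.Ioi (0 : ℝ)}
    {M : Fin m → H2 β →L[ℂ] H2 β} (hM : IsMultiplicationTuple β M) (hS : IsSpherical M)
    (i : Fin m) (n : Fin m →₀ ℕ) :
    (β n : ℝ) ^ 2 / ∏ l, ((n l).factorial : ℝ) =
      (β (Finsupp.single i n.degree) : ℝ) ^ 2 /
        ∏ l, ((Finsupp.single i n.degree l).factorial : ℝ) := by
  set G : (Fin m →₀ ℕ) → ℝ := fun n ↦ (β n : ℝ) ^ 2 / ∏ l, ((n l).factorial : ℝ) with hG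
  have hstep (q : Fin m →₀ ℕ) (j : Fin m) :
      G (q + Finsupp.single j 1) = G (q + Finsupp.single i 1) := by
    have h := hS.sq_add_single hM q j i
    have h0 : ∏ l, ((q l).factorial : ℝ) ≠ 0 :=
      Finset.prod_ne_zero_iff.2 fun l _ ↦ by exact_mod_cast Nat.factorial_ne_zero _
    have h1 : (q i : ℝ) + 1 ≠ 0 := by positivity
    have h2 : (q j : ℝ) + 1 ≠ 0 := by positivity
    simp only [hG]
    rw [prod_factorial_add_single, prod_factorial_add_single]
    field_simp
    linear_combination h
  -- The induction is on the degree still to be moved; `a` counts the units already collected at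
  -- `i`.
  have key (k : ℕ) : ∀ (q : Fin m →₀ ℕ) (a : ℕ), q.degree = k →
      G (q + Finsupp.single i a) = G (Finsupp.single i (k + a)) := by
    induction k with
    | zero =>
      intro q a hq
      rw [(Finsupp.degree_eq_zero_iff _).1 hq]
      simp only [zero_add]
    | succ k ih =>
      intro q a hq
      obtain ⟨j, hj⟩ : ∃ j, q j ≠ 0 := by
        by_contra! h
        rw [show q = 0 from Finsupp.ext h, map_zero] at hq
        omega
      have hle : Finsupp.single j 1 ≤ q :=
        Finsupp.single_le_iff.2 (Nat.one_le_iff_ne_zero.2 hj)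
      obtain ⟨q', rfl⟩ : ∃ q', q = q' + Finsupp.single j 1 :=
        ⟨q - Finsupp.single j 1, (tsub_add_cancel_of_le hle).symm⟩
      rw [map_add, Finsupp.degree_single] at hq
      rw [add_right_comm, hstep, add_assoc, ← Finsupp.single_add, ih q' (a + 1) (by omega),
        add_assoc, add_comm a 1]
  have := key n.degree n 0 rfl
  simpa only [Finsupp.single_zero, add_zero] using this

theorem IsSpherical.exists_isScalarWeight {m : ℕ} (hm : 1 ≤ m)
    {β : (Fin m →₀ ℕ) → Set.Ioi (0 : ℝ)} {M : Fin m → H2 β →L[ℂ] H2 β}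
    (hM : IsMultiplicationTuple β M) (hS : IsSpherical M) : ∃ b : ℕ → ℝ, IsScalarWeight β b := by
  let i : Fin m := ⟨0, hm⟩
  -- The value forced by `isScalarWeight_iff`: the ratio `β_n² / ‖zⁿ‖²` at `n = k ε_i`.
  let B : ℕ → ℝ := fun k ↦ (β (Finsupp.single i k) : ℝ) ^ 2 /
    (∏ l, ((Finsupp.single i k l).factorial : ℝ)) * ((m - 1 + k).factorial / (m - 1).factorial)
  have hprod (n : Fin m →₀ ℕ) : 0 < ∏ l, ((n l).factorial : ℝ) :=
    Finset.prod_pos fun l _ ↦ by exact_mod_cast Nat.factorial_pos _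
  have hB (k : ℕ) : 0 < B k := by
    have h1 := hprod (Finsupp.single i k)
    have h2 : 0 < (β (Finsupp.single i k) : ℝ) := (β _).2
    positivity
  refine ⟨fun k ↦ √(B k), (isScalarWeight_iff hm β _).2
    ⟨fun k ↦ Real.sqrt_pos.2 (hB k), fun n ↦ ?_⟩⟩
  have h := hS.sq_div_prod_factorial hM i n
  have h0 := (hprod n).ne'
  rw [Real.sq_sqrt (hB _).le, monomialNormSq]
  simp only [B]
  rw [← h]
  field_simp

end

theorem theorem2p1 {m : ℕ} (hm : 1 ≤ m) (β : (Fin m →₀ ℕ) → Set.Ioi (0 : ℝ))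
    (M : Fin m → H2 β →L[ℂ] H2 β) (hM : IsMultiplicationTuple β M) :
    (IsSpherical M ↔ ∃ b : ℕ → ℝ, IsScalarWeight β b) ∧
    ∀ b : ℕ → ℝ, IsScalarWeight β b →
      (∀ (K : Type*) [NormedAddCommGroup K] [InnerProductSpace ℂ K] [CompleteSpace K]
        (e : HilbertBasis (Fin m →₀ ℕ) ℂ K),
        ∃ T : Fin m → K →L[ℂ] K,
          IsWeightedShift e
            (fun i n => b (n.degree + 1) / b n.degree *
              √(((n i : ℝ) + 1) / ((n.degree : ℝ) + (m : ℝ)))) T ∧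
          UnitarilyEquivalent M T) ∧
      ∀ n : Fin m →₀ ℕ,
        (β n : ℝ) = b n.degree *
          √((((m - 1).factorial : ℝ) * ∏ i, ((n i).factorial : ℝ)) /
            ((m - 1 + n.degree).factorial : ℝ)) := by
  refine ⟨⟨fun hS ↦ hS.exists_isScalarWeight hm hM,
    fun ⟨b, hb⟩ ↦ isSpherical_of_isScalarWeight hm hM hb⟩, fun b hb ↦ ⟨?_, hb.coe_eq hm⟩⟩
  intro K _ _ _ e
  obtain ⟨T, hT, hMT⟩ := exists_weightedShift hM e
  have hw : (fun (i : Fin m) (n : Fin m →₀ ℕ) ↦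
      (β (n + Finsupp.single i 1) : ℝ) / β n) = fun i n ↦ b (n.degree + 1) / b n.degree *
        √(((n i : ℝ) + 1) / ((n.degree : ℝ) + (m : ℝ))) := by
    funext i n
    exact hb.div_eq hm n i
  exact ⟨T, hw ▸ hT, hMT⟩
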